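/- **Setting.** For $f\in L_2(\mathbb R)$ (complex-valued) let $\widehat f$ denote its Fourier transform, $\widehat f(u)=\int_{\mathbb R}e^{-iux}f(x)\,dx$ for integrable $f$. Let $m:\mathbb R\to[0,\infty)$ be measurable with $\int_{\mathbb R}\frac{m(u)}{u^2+1}\,du<\infty$, and let $T_m$ be the (in general unbounded) operator on $L_2(\mathbb R)$ with domain $\{f:\int m|\widehat f|^2\,du<\infty\}$ given by $\widehat{T_mf}=\sqrt m\,\widehat f$. For $k\ge 1$ let $\widetilde h_k(x)=\pi^{-1/4}((k-1)!)^{-1/2}h_{k-1}(\sqrt2x)e^{-x^2/2}$ be the Hermite functions, where $h_n(x)=(-1)^ne^{x^2/2}\frac{d^n}{dx^n}e^{-x^2/2}$; each $\widetilde h_k$ is in the domain of $T_m$, and $T_m\widetilde h_k$ has a unique continuous representative, whose value at $t$ is written $(T_m\widetilde h_k)(t)$. Let $I_t=1_{[0,t]}$ for $t>0$, $I_0=0$ and $I_t=-1_{[t,0]}$ for $t<0$; these functions are in the domain of $T_m$. Let $\Omega$ be the dual of the space of real-valued Schwartz functions on $\mathbb R$, with its Borel $\sigma$-algebra, and let $P$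 be the white noise measure, i.e. the probability measure on $\Omega$ with $\int_\Omega e^{i\langle\omega,s\rangle}dP(\omega)=e^{-\|s\|_{L_2}^2/2}$ for every real Schwartz function $s$. Let $f\mapsto Q_f$ be the complex-linear isometry $L_2(\mathbb R)\to L_2(\Omega,P)$ that extends $s\mapsto\langle\omega,s\rangle$. Let $\ell$ be the set of finitely supported sequences $\alpha=(\alpha_1,\alpha_2,\dots)$ of non-negative integers, $\epsilon^{(k)}\in\ell$ the $k$-th unit sequence, and for $\alpha\in\ell$ put $\alpha!=\prod_k\alpha_k!$, $(2\mathbb N)^\alpha=\prod_k(2k)^{\alpha_k}$, $H_\alpha=\prod_kh_{\alpha_k}(\langle\omega,\widetilde h_k\rangle)$. The Kondratiev space $S_1$ consists of the series $f=\sum_\alpha a_\alpha H_\alpha$ with $\sum_\alpha|a_\alpha|^2(\alpha!)^2(2\mathbb N)^{k\alpha}<\infty$ for all $k\in\mathbb N$; the Kondratiev space $S_{-1}$ consists of the formal series $F=\sum_\alpha b_\alpha H_\alpha$ with $\sum_\alpha|b_\alpha|^2(2\mathbb N)^{-q\alpha}<\infty$ for some $q\in\mathbb N$; the duality is $\langle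 F,f\rangle=\sum_\alpha\alpha!\,a_\alpha b_\alpha$. An element of $L_2(\Omega,P)$ with expansion $\sum_\alpha c_\alpha H_\alpha$, convergent in $L_2(\Omega,P)$, is identified with the formal series. Define the $m$-Brownian motion $B_m(t)=Q_{T_mI_t}\in L_2(\Omega,P)$ and the $m$-white noise $W_m(t)=\sum_{k=1}^\infty(T_m\widetilde h_k)(t)\,H_{\epsilon^{(k)}}$, $t\in\mathbb R$. **Theorem.** (i) $W_m(t)\in S_{-1}$ for every $t\in\mathbb R$. (ii) Assume moreover that $m$ is even, $m(-u)=m(u)$ for almost every $u$ (so that the functions $T_m\widetilde h_k$ and the variables $B_m(t)$ are real-valued). Then, for every $t\in\mathbb R$, $$B_m(t)=\int_0^tW_m(s)\,ds$$ weakly in the duality of $S_{-1}$ and $S_1$: $B_m(t)\in S_{-1}$, and for every $f\in S_1$ the function $s\mapsto\langle W_m(s),f\rangle$ is integrable between $0$ and $t$, with $\langle B_m(t),f\rangle=\int_0^t\langle W_m(s),f\rangle\,ds$. -/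

import Mathlib

open MeasureTheory Filter Topology FourierTransform
open scoped SchwartzMap

noncomputable section

theorem exists_bound_polynomial_mul_gaussian (p : Polynomial ℝ) :
    ∃ C : ℝ, ∀ x : ℝ, |p.eval x| * Real.exp (-(x ^ 2 / 2)) ≤ C := by
  have hmono : ∀ j : ℕ, ∃ C : ℝ, ∀ x : ℝ, |x ^ j| * Real.exp (-(x ^ 2 / 2)) ≤ C := by
    intro j
    refine ⟨1 + 2 ^ j * j.factorial, fun x => ?_⟩
    have h1 : (x ^ 2 / 2) ^ j / j.factorial ≤ Real.exp (x ^ 2 / 2) :=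
      Real.pow_div_factorial_le_exp _ (by positivity) j
    have h2 : |x ^ j| ≤ 1 + (x ^ 2) ^ j := by
      have : (x ^ 2) ^ j = |x ^ j| ^ 2 := by rw [sq_abs]; ring
      rw [this]; nlinarith [sq_nonneg (|x ^ j| - 1), abs_nonneg (x ^ j)]
    have h3 : (x ^ 2) ^ j ≤ 2 ^ j * j.factorial * Real.exp (x ^ 2 / 2) := by
      rw [div_pow, div_div, div_le_iff₀ (by positivity)] at h1
      linarith
    have h4 : Real.exp (x ^ 2 / 2) * Real.exp (-(x ^ 2 / 2)) = 1 := by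
      rw [← Real.exp_add]; simp
    have h5 : Real.exp (-(x ^ 2 / 2)) ≤ 1 := Real.exp_le_one_iff.2 (by
      have := sq_nonneg x; linarith)
    have h6 := Real.exp_pos (-(x ^ 2 / 2))
    calc |x ^ j| * Real.exp (-(x ^ 2 / 2))
        ≤ (1 + 2 ^ j * j.factorial * Real.exp (x ^ 2 / 2)) * Real.exp (-(x ^ 2 / 2)) := by
          gcongr; linarith
      _ = Real.exp (-(x ^ 2 / 2)) + 2 ^ j * j.factorial *
          (Real.exp (x ^ 2 / 2) * Real.exp (-(x ^ 2 / 2))) := by ring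
      _ ≤ _ := by rw [h4]; linarith
  induction p using Polynomial.induction_on' with
  | add p q hp hq =>
    obtain ⟨A, hA⟩ := hp
    obtain ⟨B, hB⟩ := hq
    refine ⟨A + B, fun x => ?_⟩
    rw [Polynomial.eval_add]
    have := abs_add_le (p.eval x) (q.eval x)
    have h6 := Real.exp_pos (-(x ^ 2 / 2))
    nlinarith [hA x, hB x]
  | monomial n a =>
    obtain ⟨C, hC⟩ := hmono n
    refine ⟨|a| * C, fun x => ?_⟩
    rw [Polynomial.eval_monomial, abs_mul, mul_assoc]
    exact mul_le_mul_of_nonneg_left (hC x) (abs_nonneg a)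

theorem hasTemperateGrowth_polynomial (p : Polynomial ℝ) :
    Function.HasTemperateGrowth (fun x : ℝ => p.eval x) := by
  induction p using Polynomial.induction_on' with
  | add p q hp hq => simpa [Polynomial.eval_add] using! hp.add hq
  | monomial n a =>
    simpa [Polynomial.eval_monomial] using!
      (Function.HasTemperateGrowth.const (E := ℝ) a).mul
        ((Function.HasTemperateGrowth.id' (E := ℝ)).pow n)

/-- The Gaussian `x ↦ exp (-x² / 2)` as a Schwartz function. -/
def gaussianSchwartz : 𝓢(ℝ, ℝ) where
  toFun x := Real.exp (-(x ^ 2 / 2))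
  smooth' := by fun_prop
  decay' := by
    intro k n
    obtain ⟨C, hC⟩ := exists_bound_polynomial_mul_gaussian
      (Polynomial.X ^ k * (Polynomial.hermite n).map (algebraMap ℤ ℝ))
    refine ⟨C, fun x => ?_⟩
    refine le_trans (le_of_eq ?_) (hC x)
    rw [norm_iteratedFDeriv_eq_norm_iteratedDeriv, iteratedDeriv_eq_iterate,
      Polynomial.deriv_gaussian_eq_hermite_mul_gaussian]
    simp [abs_mul, Polynomial.aeval_def, Polynomial.eval_map, mul_assoc]

/-- The Hermite function `h̃_{k+1}`. -/
def hermiteFun (k : ℕ) : 𝓢(ℝ, ℝ) :=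
  SchwartzMap.smulLeftCLM ℝ
    (fun x : ℝ => Polynomial.aeval (√2 * x) (Polynomial.hermite k) /
      (Real.pi ^ (1 / 4 : ℝ) * √(k.factorial : ℝ))) gaussianSchwartz

theorem hermiteFun_apply (k : ℕ) (x : ℝ) :
    hermiteFun k x = Polynomial.aeval (√2 * x) (Polynomial.hermite k) * Real.exp (-(x ^ 2 / 2)) /
      (Real.pi ^ (1 / 4 : ℝ) * √(k.factorial : ℝ)) := by
  have h : Function.HasTemperateGrowth (fun x : ℝ =>
      Polynomial.aeval (√2 * x) (Polynomial.hermite k) /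
        (Real.pi ^ (1 / 4 : ℝ) * √(k.factorial : ℝ))) := by
    convert hasTemperateGrowth_polynomial
      (Polynomial.C (Real.pi ^ (1 / 4 : ℝ) * √(k.factorial : ℝ))⁻¹ *
        ((Polynomial.hermite k).map (algebraMap ℤ ℝ)).comp
          (Polynomial.C √2 * Polynomial.X)) using 2 with x
    simp only [Polynomial.aeval_def, Polynomial.eval_mul, Polynomial.eval_C, Polynomial.eval_comp,
      Polynomial.eval_map, Polynomial.eval_X]
    ring
  rw [hermiteFun, SchwartzMap.smulLeftCLM_apply_apply h]
  change _ • Real.exp _ = _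
  rw [smul_eq_mul]; ring

/-- `Ω = 𝓢_ℝ(ℝ)'`, the dual of the space of real-valued Schwartz functions. -/
abbrev WNSpace : Type := 𝓢(ℝ, ℝ) →L[ℝ] ℝ

instance : MeasurableSpace WNSpace := borel WNSpace

instance : BorelSpace WNSpace := ⟨rfl⟩

/-- The white noise measure on `Ω`: the Borel probability measure with
`E[exp(i ⟨ω, s⟩)] = exp(-‖s‖² / 2)` for every real Schwartz function `s`. -/
class IsWhiteNoiseMeasure (P : Measure WNSpace) : Prop where
  isProbabilityMeasure : IsProbabilityMeasure P
  charFun_eq : ∀ s : 𝓢(ℝ, ℝ),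
    ∫ ω : WNSpace, Complex.exp (Complex.I * (ω s : ℂ)) ∂P =
      Complex.exp (-((∫ x : ℝ, s x ^ 2 : ℝ) : ℂ) / 2)

section WhiteNoise

theorem norm_toLp_sq {X : Type*} [MeasurableSpace X] {μ : Measure X} {f : X → ℂ}
    (hf : MemLp f 2 μ) : ‖hf.toLp‖ ^ 2 = ∫ x, ‖f x‖ ^ 2 ∂μ := by
  have h0 : 0 ≤ ∫ x, ‖f x‖ ^ 2 ∂μ := integral_nonneg fun x => by positivity
  rw [Lp.norm_toLp, hf.eLpNorm_eq_integral_rpow_norm (by simp) (by simp)]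
  simp only [ENNReal.toReal_ofNat, Real.rpow_ofNat]
  rw [ENNReal.toReal_ofReal (by positivity), ← Real.rpow_natCast, ← Real.rpow_mul h0]
  simp

variable (P : Measure WNSpace) [hP : IsWhiteNoiseMeasure P]

theorem measurable_wnEval (s : 𝓢(ℝ, ℝ)) : Measurable (fun ω : WNSpace => ω s) := by
  have : Continuous (fun ω : WNSpace => ω s) := by fun_prop
  exact this.measurable

theorem map_wnEval (s : 𝓢(ℝ, ℝ)) :
    P.map (fun ω : WNSpace => ω s) =
      ProbabilityTheory.gaussianReal 0 (Real.toNNReal (∫ x : ℝ, s x ^ 2)) := by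
  have := hP.isProbabilityMeasure
  have : IsProbabilityMeasure (P.map (fun ω : WNSpace => ω s)) :=
    Measure.isProbabilityMeasure_map (measurable_wnEval s).aemeasurable
  apply Measure.ext_of_charFun
  ext t
  rw [charFun_apply_real, ProbabilityTheory.charFun_gaussianReal,
    integral_map (measurable_wnEval s).aemeasurable (by fun_prop)]
  have h := hP.charFun_eq (t • s)
  have h0 : 0 ≤ ∫ x : ℝ, s x ^ 2 := integral_nonneg fun x => sq_nonneg _
  have h1 : ∫ x : ℝ, (t • s) x ^ 2 = t ^ 2 * ∫ x : ℝ, s x ^ 2 := by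
    rw [← integral_const_mul]; simp [mul_pow]
  rw [h1] at h
  convert h using 1
  · congr 1 with ω
    congr 1
    simp; ring
  · rw [Real.coe_toNNReal _ h0]
    congr 1
    push_cast; ring

theorem memLp_wnEval (s : 𝓢(ℝ, ℝ)) : MemLp (fun ω : WNSpace => ω s) 2 P := by
  have h := ProbabilityTheory.memLp_id_gaussianReal' (μ := 0)
    (v := Real.toNNReal (∫ x : ℝ, s x ^ 2)) 2 (by simp)
  rw [← map_wnEval P s, memLp_map_measure_iff (by fun_prop)
    (measurable_wnEval s).aemeasurable] at h
  exact h

theorem integral_wnEval_sq (s : 𝓢(ℝ, ℝ)) : ∫ ω : WNSpace, ω s ^ 2 ∂P = ∫ x : ℝ, s x ^ 2 := by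
  have h0 : 0 ≤ ∫ x : ℝ, s x ^ 2 := integral_nonneg fun x => sq_nonneg _
  have h := ProbabilityTheory.variance_id_gaussianReal (μ := 0)
    (v := Real.toNNReal (∫ x : ℝ, s x ^ 2))
  rw [ProbabilityTheory.variance_of_integral_eq_zero aemeasurable_id
    (by simp [ProbabilityTheory.integral_id_gaussianReal]), ← map_wnEval P s,
    integral_map (measurable_wnEval s).aemeasurable (by fun_prop), Real.coe_toNNReal _ h0] at h
  simpa using h

/-- `Q_s(ω) = ⟨ω, Re s⟩ + i ⟨ω, Im s⟩` for a complex-valued Schwartz function `s`. -/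
def wnPairing (s : 𝓢(ℝ, ℂ)) (ω : WNSpace) : ℂ :=
  (ω (s.postcompCLM Complex.reCLM) : ℂ) + Complex.I * (ω (s.postcompCLM Complex.imCLM) : ℂ)

theorem memLp_wnPairing (s : 𝓢(ℝ, ℂ)) : MemLp (wnPairing s) 2 P := by
  have h1 : MemLp (fun ω : WNSpace => (ω (s.postcompCLM Complex.reCLM) : ℂ)) 2 P :=
    (memLp_wnEval P _).ofReal
  have h2 : MemLp (fun ω : WNSpace => (ω (s.postcompCLM Complex.imCLM) : ℂ)) 2 P :=
    (memLp_wnEval P _).ofReal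
  exact h1.add (h2.const_mul Complex.I)

/-- `s ↦ Q_s` as a linear map into `L²(Ω, P)`. -/
def wnSchwartz : 𝓢(ℝ, ℂ) →ₗ[ℂ] Lp ℂ 2 P where
  toFun s := (memLp_wnPairing P s).toLp
  map_add' s t := by
    rw [← MemLp.toLp_add]
    apply MemLp.toLp_congr
    refine ae_of_all _ fun ω => ?_
    simp only [wnPairing, map_add, Pi.add_apply]
    push_cast; ring
  map_smul' c s := by
    rw [RingHom.id_apply, ← MemLp.toLp_const_smul]
    apply MemLp.toLp_congr
    refine ae_of_all _ fun ω => ?_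
    have hre : (c • s).postcompCLM Complex.reCLM =
        c.re • s.postcompCLM Complex.reCLM - c.im • s.postcompCLM Complex.imCLM := by
      ext x; simp
    have him : (c • s).postcompCLM Complex.imCLM =
        c.re • s.postcompCLM Complex.imCLM + c.im • s.postcompCLM Complex.reCLM := by
      ext x; simp
    simp only [wnPairing, hre, him, map_add, map_sub, map_smul, Pi.smul_apply, smul_eq_mul]
    push_cast
    conv_rhs => rw [← Complex.re_add_im c]
    linear_combination -(c.im * (ω (s.postcompCLM Complex.imCLM)) : ℂ) * Complex.I_sq

/-- The isometry `f ↦ Q_f` from `L²(ℝ; ℂ)` into `L²(Ω, P)`, extended by density from Schwartz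
functions. -/
def wnQ : Lp ℂ 2 (volume : Measure ℝ) →L[ℂ] Lp ℂ 2 P :=
  (wnSchwartz P).extendOfNorm (SchwartzMap.toLpCLM ℂ ℂ 2 (volume : Measure ℝ)).toLinearMap

theorem norm_wnSchwartz (s : 𝓢(ℝ, ℂ)) : ‖wnSchwartz P s‖ = ‖s.toLp 2 (volume : Measure ℝ)‖ := by
  have hsq : ∀ u : 𝓢(ℝ, ℝ), Integrable (fun x => u x ^ 2) :=
    fun u => (u.memLp 2 (volume : Measure ℝ)).integrable_sq
  have h1 : ‖wnSchwartz P s‖ ^ 2 = ∫ ω, ‖wnPairing s ω‖ ^ 2 ∂P :=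
    norm_toLp_sq (memLp_wnPairing P s)
  have h2 : ‖s.toLp 2 (volume : Measure ℝ)‖ ^ 2 = ∫ x, ‖s x‖ ^ 2 :=
    norm_toLp_sq (s.memLp 2 (volume : Measure ℝ))
  have h3 : ∀ ω : WNSpace, ‖wnPairing s ω‖ ^ 2 =
      ω (s.postcompCLM Complex.reCLM) ^ 2 + ω (s.postcompCLM Complex.imCLM) ^ 2 := by
    intro ω
    rw [wnPairing, mul_comm, Complex.sq_norm, Complex.normSq_add_mul_I]
  have h4 : ∀ x, ‖s x‖ ^ 2 =
      (s.postcompCLM Complex.reCLM) x ^ 2 + (s.postcompCLM Complex.imCLM) x ^ 2 := by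
    intro x
    rw [Complex.sq_norm, Complex.normSq_apply]
    simp [sq]
  rw [← sq_eq_sq₀ (norm_nonneg _) (norm_nonneg _), h1, h2]
  simp_rw [h3, h4]
  rw [integral_add (memLp_wnEval P _).integrable_sq (memLp_wnEval P _).integrable_sq,
    integral_add (hsq _) (hsq _), integral_wnEval_sq, integral_wnEval_sq]

theorem wnQ_toLp (s : 𝓢(ℝ, ℂ)) : wnQ P (s.toLp 2) = wnSchwartz P s :=
  LinearMap.extendOfNorm_eq (f := wnSchwartz P)
    (e := (SchwartzMap.toLpCLM ℂ ℂ 2 (volume : Measure ℝ)).toLinearMap)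
    (SchwartzMap.denseRange_toLpCLM (p := 2) ENNReal.ofNat_ne_top)
    ⟨1, fun s => by rw [one_mul]; exact (norm_wnSchwartz P s).le⟩ s

/-- `H_α(ω) = ∏_k h_{α_k}(⟨ω, h̃_k⟩)`. -/
def chaosBasis (α : ℕ →₀ ℕ) (ω : WNSpace) : ℝ :=
  α.prod fun k n => Polynomial.aeval (ω (hermiteFun k)) (Polynomial.hermite n)

end WhiteNoise

section Operator

/-- The standing assumptions on the spectral density `m`. -/
structure IsSpectralDensity (m : ℝ → ℝ) : Prop where
  nonneg : ∀ u, 0 ≤ m u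
  measurable : Measurable m
  integrable : Integrable (fun u : ℝ => m u / (u ^ 2 + 1))

/-- Mathlib's Fourier transform is `𝓕 f ξ = ∫ exp(-2πi x ξ) f x`, so that
`f̂(u) = ∫ exp(-iux) f x` is `𝓕 f (u / (2π))`; multiplication of `f̂` by `√m(u)` is therefore
multiplication of `𝓕 f` by `√m(2πξ)`. -/
def TmSymbol (m : ℝ → ℝ) (f : Lp ℂ 2 (volume : Measure ℝ)) (ξ : ℝ) : ℂ :=
  (√(m (2 * Real.pi * ξ)) : ℂ) * (𝓕 f : Lp ℂ 2 (volume : Measure ℝ)) ξ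

theorem TmSymbol_add (m : ℝ → ℝ) (f g : Lp ℂ 2 (volume : Measure ℝ)) :
    TmSymbol m (f + g) =ᵐ[volume] TmSymbol m f + TmSymbol m g := by
  have h : (𝓕 (f + g) : Lp ℂ 2 (volume : Measure ℝ)) = 𝓕 f + 𝓕 g := FourierTransform.fourier_add f g
  unfold TmSymbol
  rw [h]
  filter_upwards [Lp.coeFn_add (𝓕 f : Lp ℂ 2 (volume : Measure ℝ)) (𝓕 g)] with ξ hξ
  simp only [hξ, Pi.add_apply, mul_add]

theorem TmSymbol_smul (m : ℝ → ℝ) (c : ℂ) (f : Lp ℂ 2 (volume : Measure ℝ)) :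
    TmSymbol m (c • f) =ᵐ[volume] c • TmSymbol m f := by
  have h : (𝓕 (c • f) : Lp ℂ 2 (volume : Measure ℝ)) = c • 𝓕 f := FourierTransform.fourier_smul c f
  unfold TmSymbol
  rw [h]
  filter_upwards [Lp.coeFn_smul c (𝓕 f : Lp ℂ 2 (volume : Measure ℝ))] with ξ hξ
  simp only [hξ, Pi.smul_apply, smul_eq_mul]
  ring

theorem TmSymbol_zero (m : ℝ → ℝ) : TmSymbol m 0 =ᵐ[volume] 0 := by
  simpa using TmSymbol_smul m 0 0

/-- The domain of `T_m`: those `f ∈ L²(ℝ)` with `∫ m(u) |f̂(u)|² du < ∞`. -/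
def TmDomain (m : ℝ → ℝ) : Submodule ℂ (Lp ℂ 2 (volume : Measure ℝ)) where
  carrier := {f | MemLp (TmSymbol m f) 2 volume}
  add_mem' hf hg := (memLp_congr_ae (TmSymbol_add m _ _)).2 (hf.add hg)
  zero_mem' := (memLp_congr_ae (TmSymbol_zero m)).2 MemLp.zero
  smul_mem' c _ hf := (memLp_congr_ae (TmSymbol_smul m c _)).2 (hf.const_smul c)

theorem memLp_TmSymbol {m : ℝ → ℝ} (f : TmDomain m) : MemLp (TmSymbol m f.1) 2 volume := f.2

/-- The (in general unbounded) operator `T_m` on `L²(ℝ)`, given by `(T_m f)^ = √m f̂`. -/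
def Tm (m : ℝ → ℝ) : Lp ℂ 2 (volume : Measure ℝ) →ₗ.[ℂ] Lp ℂ 2 (volume : Measure ℝ) where
  domain := TmDomain m
  toFun :=
    { toFun := fun f => 𝓕⁻ (memLp_TmSymbol f).toLp
      map_add' := fun f g => by
        rw [← FourierTransform.fourierInv_add, ← MemLp.toLp_add]
        congr 1
        exact MemLp.toLp_congr _ _ (TmSymbol_add m _ _)
      map_smul' := fun c f => by
        rw [RingHom.id_apply, ← FourierTransform.fourierInv_smul, ← MemLp.toLp_const_smul]
        congr 1
        exact MemLp.toLp_congr _ _ (TmSymbol_smul m c _) }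

theorem mem_TmDomain_of_decay {m : ℝ → ℝ} (hm : IsSpectralDensity m)
    {f : Lp ℂ 2 (volume : Measure ℝ)} (C : ℝ)
    (h : ∀ᵐ ξ : ℝ, ‖(𝓕 f : Lp ℂ 2 (volume : Measure ℝ)) ξ‖ ^ 2 *
      ((2 * Real.pi * ξ) ^ 2 + 1) ≤ C) : f ∈ TmDomain m := by
  have hpi : (2 * Real.pi) ≠ 0 := by positivity
  have hmeas : AEStronglyMeasurable (TmSymbol m f) volume := by
    refine AEStronglyMeasurable.mul ?_ (Lp.aestronglyMeasurable _)
    have := hm.measurable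
    exact (by fun_prop : Measurable fun ξ : ℝ => (√(m (2 * Real.pi * ξ)) : ℂ)).aestronglyMeasurable
  change MemLp (TmSymbol m f) 2 volume
  rw [memLp_two_iff_integrable_sq_norm hmeas]
  have hint : Integrable (fun ξ : ℝ => C * (m (2 * Real.pi * ξ) /
      ((2 * Real.pi * ξ) ^ 2 + 1))) := (hm.integrable.comp_mul_left' hpi).const_mul C
  refine hint.mono' (by fun_prop) ?_
  filter_upwards [h] with ξ hξ
  have h0 := hm.nonneg (2 * Real.pi * ξ)
  rw [Real.norm_of_nonneg (by positivity), TmSymbol, norm_mul, mul_pow, Complex.norm_real,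
    Real.norm_eq_abs, sq_abs, Real.sq_sqrt h0, ← mul_div_assoc, le_div_iff₀ (by positivity)]
  nlinarith

/-- The complex-valued version of `h̃_{k+1}` as an element of `L²(ℝ)`. -/
def hermiteL2 (k : ℕ) : Lp ℂ 2 (volume : Measure ℝ) :=
  ((hermiteFun k).postcompCLM Complex.ofRealCLM).toLp 2

theorem hermiteL2_mem_TmDomain {m : ℝ → ℝ} (hm : IsSpectralDensity m) (k : ℕ) :
    hermiteL2 k ∈ TmDomain m := by
  set g : 𝓢(ℝ, ℂ) := 𝓕 ((hermiteFun k).postcompCLM Complex.ofRealCLM) with hg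
  obtain ⟨A, -, hA⟩ := g.decay 0 0
  obtain ⟨B, -, hB⟩ := g.decay 1 0
  refine mem_TmDomain_of_decay hm ((2 * Real.pi) ^ 2 * B ^ 2 + A ^ 2) ?_
  rw [hermiteL2, SchwartzMap.toLp_fourier_eq, ← hg]
  filter_upwards [g.coeFn_toLp 2 (volume : Measure ℝ)] with ξ hξ
  rw [hξ]
  have h1 : ‖g ξ‖ ^ 2 ≤ A ^ 2 := by
    have := hA ξ
    simp only [pow_zero, one_mul, norm_iteratedFDeriv_zero] at this
    gcongr
  have h2 : (‖ξ‖ * ‖g ξ‖) ^ 2 ≤ B ^ 2 := by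
    have := hB ξ
    simp only [pow_one, norm_iteratedFDeriv_zero] at this
    gcongr
  rw [mul_pow, Real.norm_eq_abs, sq_abs] at h2
  calc ‖g ξ‖ ^ 2 * ((2 * Real.pi * ξ) ^ 2 + 1)
      = (2 * Real.pi) ^ 2 * (ξ ^ 2 * ‖g ξ‖ ^ 2) + ‖g ξ‖ ^ 2 := by ring
    _ ≤ _ := by gcongr

/-- `I_t = 1_{[0,t]}` for `t > 0`, `I_t = -1_{[t,0]}` for `t < 0`, and `I_0 = 0`; with this sign
the integral of `f * I_t` is the oriented integral of `f` from `0` to `t`. -/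
def indicatorFun (t x : ℝ) : ℂ :=
  (Set.Icc 0 t).indicator (fun _ => (1 : ℂ)) x - (Set.Icc t 0).indicator (fun _ => (1 : ℂ)) x

theorem memLp_indicatorFun (t : ℝ) (p : ENNReal) :
    MemLp (indicatorFun t) p (volume : Measure ℝ) :=
  (memLp_indicator_const p measurableSet_Icc _ (Or.inr (by simp))).sub
    (memLp_indicator_const p measurableSet_Icc _ (Or.inr (by simp)))

/-- `I_t` as an element of `L²(ℝ)`. -/
def indicatorL2 (t : ℝ) : Lp ℂ 2 (volume : Measure ℝ) := (memLp_indicatorFun t 2).toLp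

theorem integral_mul_indicatorFun (t : ℝ) {g : ℝ → ℂ} (hg : Continuous g) :
    ∫ x, g x * indicatorFun t x = ∫ x in (0 : ℝ)..t, g x := by
  have key : ∀ a b : ℝ, (fun x => g x * (Set.Icc a b).indicator (fun _ => (1 : ℂ)) x) =
      (Set.Icc a b).indicator g := by
    intro a b
    ext x
    by_cases hx : x ∈ Set.Icc a b <;> simp [hx]
  have hi : ∀ a b : ℝ, Integrable ((Set.Icc a b).indicator g) := fun a b =>
    (integrable_indicator_iff measurableSet_Icc).2 hg.integrableOn_Icc
  simp only [indicatorFun, mul_sub]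
  rw [integral_sub (by rw [key]; exact hi _ _) (by rw [key]; exact hi _ _), key, key,
    integral_indicator measurableSet_Icc, integral_indicator measurableSet_Icc,
    integral_Icc_eq_integral_Ioc, integral_Icc_eq_integral_Ioc, intervalIntegral]

theorem fourier_toLp_ae {f : ℝ → ℂ} (h1 : Integrable f) (h2 : MemLp f 2 volume) :
    ((𝓕 h2.toLp : Lp ℂ 2 (volume : Measure ℝ)) : ℝ → ℂ) =ᵐ[volume] 𝓕 f := by
  have hcont : Continuous (𝓕 f) :=
    VectorFourier.fourierIntegral_continuous Real.continuous_fourierChar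
      (by exact continuous_inner) h1
  apply ae_eq_of_integral_contDiff_smul_eq
  · exact (Lp.memLp _).locallyIntegrable (by norm_num)
  · exact hcont.locallyIntegrable
  intro g hg hgs
  have hgc : HasCompactSupport (fun x => (g x : ℂ)) := hgs.comp_left (g := Complex.ofReal) rfl
  have hgd : ContDiff ℝ ((⊤ : ℕ∞) : WithTop ℕ∞) (fun x => (g x : ℂ)) :=
    Complex.ofRealCLM.contDiff.comp hg
  set φ : 𝓢(ℝ, ℂ) := hgc.toSchwartzMap hgd with hφ
  have hφx : ∀ x, φ x = g x := fun x => rfl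
  have e1 := congrArg (fun T : 𝓢'(ℝ, ℂ) => T φ) (Lp.fourier_toTemperedDistribution_eq h2.toLp)
  simp only [TemperedDistribution.fourier_apply, Lp.toTemperedDistribution_apply] at e1
  have e2 : ∫ x, (𝓕 φ : 𝓢(ℝ, ℂ)) x • f x = ∫ x, φ x • (𝓕 f) x := by
    have := VectorFourier.integral_fourierIntegral_smul_eq_flip (L := innerₗ ℝ)
      (μ := volume) (ν := volume) Real.continuous_fourierChar
      (by exact continuous_inner) (φ.integrable (μ := volume)) h1
    simpa using! this
  calc ∫ x, g x • (𝓕 h2.toLp : Lp ℂ 2 (volume : Measure ℝ)) x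
      = ∫ x, φ x • (𝓕 h2.toLp : Lp ℂ 2 (volume : Measure ℝ)) x := by
        simp [hφx]
    _ = ∫ x, (𝓕 φ : 𝓢(ℝ, ℂ)) x • (h2.toLp : Lp ℂ 2 (volume : Measure ℝ)) x := e1.symm
    _ = ∫ x, (𝓕 φ : 𝓢(ℝ, ℂ)) x • f x := by
        apply integral_congr_ae
        filter_upwards [h2.coeFn_toLp] with x hx
        rw [hx]
    _ = _ := by rw [e2]; simp [hφx]

theorem indicatorL2_mem_TmDomain {m : ℝ → ℝ} (hm : IsSpectralDensity m) (t : ℝ) :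
    indicatorL2 t ∈ TmDomain m := by
  refine mem_TmDomain_of_decay hm (4 + t ^ 2) ?_
  filter_upwards [fourier_toLp_ae (memLp_one_iff_integrable.1 (memLp_indicatorFun t 1))
    (memLp_indicatorFun t 2)] with ξ hξ
  rw [indicatorL2, hξ]
  set c : ℂ := ((-2 * Real.pi * ξ : ℝ) : ℂ) * Complex.I with hc
  have hexp : ∀ x : ℝ, ‖Complex.exp (c * x)‖ = 1 := by
    intro x
    rw [hc, mul_right_comm, ← Complex.ofReal_mul, Complex.norm_exp_ofReal_mul_I]
  have hF : 𝓕 (indicatorFun t) ξ = ∫ x in (0 : ℝ)..t, Complex.exp (c * x) := by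
    rw [Real.fourier_real_eq_integral_exp_smul, ← integral_mul_indicatorFun t (by fun_prop)]
    congr 1 with x
    rw [smul_eq_mul, hc]
    congr 2
    push_cast; ring
  rw [hF]
  have b1 : ‖∫ x in (0 : ℝ)..t, Complex.exp (c * x)‖ ≤ |t| := by
    simpa using intervalIntegral.norm_integral_le_of_norm_le_const (a := 0) (b := t) (C := 1)
      (f := fun x : ℝ => Complex.exp (c * x)) fun x _ => (hexp x).le
  have b2 : ‖∫ x in (0 : ℝ)..t, Complex.exp (c * x)‖ * |2 * Real.pi * ξ| ≤ 2 := by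
    by_cases h0 : c = 0
    · have : 2 * Real.pi * ξ = 0 := by
        have := congrArg norm h0
        simpa [hc] using this
      simp [this]
    · have hn : ‖c‖ = |2 * Real.pi * ξ| := by
        rw [hc, norm_mul, Complex.norm_I, mul_one, Complex.norm_real, Real.norm_eq_abs,
          neg_mul, neg_mul, abs_neg]
      rw [integral_exp_mul_complex h0, norm_div, ← hn, div_mul_cancel₀ _ (norm_ne_zero_iff.2 h0)]
      refine (norm_sub_le _ _).trans ?_
      rw [hexp, hexp]; norm_num
  have c1 := pow_le_pow_left₀ (norm_nonneg _) b1 2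
  have c2 := pow_le_pow_left₀ (by positivity) b2 2
  rw [mul_pow, sq_abs] at c2
  rw [sq_abs] at c1
  nlinarith

theorem fourierInv_toLp_ae {f : ℝ → ℂ} (h1 : Integrable f) (h2 : MemLp f 2 volume) :
    ((𝓕⁻ h2.toLp : Lp ℂ 2 (volume : Measure ℝ)) : ℝ → ℂ) =ᵐ[volume] 𝓕⁻ f := by
  have hcont : Continuous (𝓕⁻ f) :=
    VectorFourier.fourierIntegral_continuous Real.continuous_fourierChar
      (by exact continuous_inner.neg) h1
  apply ae_eq_of_integral_contDiff_smul_eq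
  · exact (Lp.memLp _).locallyIntegrable (by norm_num)
  · exact hcont.locallyIntegrable
  intro g hg hgs
  have hgc : HasCompactSupport (fun x => (g x : ℂ)) := hgs.comp_left (g := Complex.ofReal) rfl
  have hgd : ContDiff ℝ ((⊤ : ℕ∞) : WithTop ℕ∞) (fun x => (g x : ℂ)) :=
    Complex.ofRealCLM.contDiff.comp hg
  set φ : 𝓢(ℝ, ℂ) := hgc.toSchwartzMap hgd with hφ
  have hφx : ∀ x, φ x = g x := fun x => rfl
  have e1 := congrArg (fun T : 𝓢'(ℝ, ℂ) => T φ) (Lp.fourierInv_toTemperedDistribution_eq h2.toLp)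
  simp only [TemperedDistribution.fourierInv_apply, Lp.toTemperedDistribution_apply] at e1
  have e2 : ∫ x, (𝓕⁻ φ : 𝓢(ℝ, ℂ)) x • f x = ∫ x, φ x • (𝓕⁻ f) x := by
    have := VectorFourier.integral_fourierIntegral_smul_eq_flip (L := -innerₗ ℝ)
      (μ := volume) (ν := volume) Real.continuous_fourierChar
      (by exact continuous_inner.neg) (φ.integrable (μ := volume)) h1
    have hflip : (-innerₗ ℝ).flip = -innerₗ ℝ := by ext; simp
    rw [hflip] at this
    rw [SchwartzMap.fourierInv_coe]
    exact this
  calc ∫ x, g x • (𝓕⁻ h2.toLp : Lp ℂ 2 (volume : Measure ℝ)) x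
      = ∫ x, φ x • (𝓕⁻ h2.toLp : Lp ℂ 2 (volume : Measure ℝ)) x := by
        simp [hφx]
    _ = ∫ x, (𝓕⁻ φ : 𝓢(ℝ, ℂ)) x • (h2.toLp : Lp ℂ 2 (volume : Measure ℝ)) x := e1.symm
    _ = ∫ x, (𝓕⁻ φ : 𝓢(ℝ, ℂ)) x • f x := by
        apply integral_congr_ae
        filter_upwards [h2.coeFn_toLp] with x hx
        rw [hx]
    _ = _ := by rw [e2]; simp [hφx]

theorem integrable_TmSymbol_hermiteL2 {m : ℝ → ℝ} (hm : IsSpectralDensity m) (k : ℕ) :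
    Integrable (TmSymbol m (hermiteL2 k)) := by
  have hpi : (2 * Real.pi) ≠ 0 := by positivity
  set g : 𝓢(ℝ, ℂ) := 𝓕 ((hermiteFun k).postcompCLM Complex.ofRealCLM) with hg
  have hmem : MemLp (TmSymbol m (hermiteL2 k)) 2 volume := hermiteL2_mem_TmDomain hm k
  have hi0 : Integrable (fun ξ : ℝ => ‖g ξ‖ ^ 2) :=
    (g.memLp 2 (volume : Measure ℝ)).norm.integrable_sq
  have hi2 : Integrable (fun ξ : ℝ => (‖ξ‖ * ‖g ξ‖) ^ 2) := by
    have h := (SchwartzMap.smulLeftCLM ℂ (fun x : ℝ => x) g).memLp 2 (volume : Measure ℝ)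
    refine h.norm.integrable_sq.congr (ae_of_all _ fun ξ => ?_)
    simp only [SchwartzMap.smulLeftCLM_apply_apply Function.HasTemperateGrowth.id', norm_smul]
  have hint := (hm.integrable.comp_mul_left' hpi).add ((hi2.const_mul ((2 * Real.pi) ^ 2)).add hi0)
  refine hint.mono' hmem.1 ?_
  rw [show TmSymbol m (hermiteL2 k) = fun ξ => (√(m (2 * Real.pi * ξ)) : ℂ) *
    (g.toLp 2 (volume : Measure ℝ)) ξ by
      ext ξ; rw [TmSymbol, hermiteL2, SchwartzMap.toLp_fourier_eq]]
  filter_upwards [g.coeFn_toLp 2 (volume : Measure ℝ)] with ξ hξ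
  have h0 := hm.nonneg (2 * Real.pi * ξ)
  rw [hξ, norm_mul, Complex.norm_real, Real.norm_of_nonneg (Real.sqrt_nonneg _)]
  simp only [Pi.add_apply]
  set v := (2 * Real.pi * ξ) ^ 2 + 1 with hv
  have hvpos : 0 < v := by positivity
  have e1 : (2 * Real.pi) ^ 2 * (‖ξ‖ * ‖g ξ‖) ^ 2 + ‖g ξ‖ ^ 2 = (√v * ‖g ξ‖) ^ 2 := by
    rw [mul_pow √v, Real.sq_sqrt hvpos.le, hv, mul_pow ‖ξ‖, Real.norm_eq_abs, sq_abs]; ring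
  have e2 : m (2 * Real.pi * ξ) / v = (√(m (2 * Real.pi * ξ)) / √v) ^ 2 := by
    rw [div_pow, Real.sq_sqrt h0, Real.sq_sqrt hvpos.le]
  have e3 : √(m (2 * Real.pi * ξ)) * ‖g ξ‖ = (√(m (2 * Real.pi * ξ)) / √v) * (√v * ‖g ξ‖) := by
    have : √v ≠ 0 := (Real.sqrt_pos.2 hvpos).ne'
    field_simp
  rw [e1, e2, e3]
  nlinarith [sq_nonneg ((√(m (2 * Real.pi * ξ)) / √v) - (√v * ‖g ξ‖)),
    sq_nonneg (√(m (2 * Real.pi * ξ)) / √v), sq_nonneg (√v * ‖g ξ‖)]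

theorem exists_continuous_Tm_hermite {m : ℝ → ℝ} (hm : IsSpectralDensity m) (k : ℕ) :
    ∃ g : ℝ → ℂ, Continuous g ∧
      Tm m ⟨hermiteL2 k, hermiteL2_mem_TmDomain hm k⟩ =ᵐ[volume] g := by
  refine ⟨𝓕⁻ (TmSymbol m (hermiteL2 k)), ?_, ?_⟩
  · exact VectorFourier.fourierIntegral_continuous Real.continuous_fourierChar
      (by exact continuous_inner.neg) (integrable_TmSymbol_hermiteL2 hm k)
  · exact fourierInv_toLp_ae (integrable_TmSymbol_hermiteL2 hm k)
      (hermiteL2_mem_TmDomain hm k)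

/-- The function `T_m h̃_{k+1}`: the continuous function in the `L²`-class `T_m h̃_{k+1}`
(there is exactly one). -/
def TmHermite {m : ℝ → ℝ} (hm : IsSpectralDensity m) (k : ℕ) : ℝ → ℂ :=
  (exists_continuous_Tm_hermite hm k).choose

end Operator

section Kondratiev

/-- Coefficient families `(c_α)_{α ∈ ℓ}` of formal series `∑ c_α H_α`. The index `k : ℕ` stands for
the position `k + 1` of a sequence `α ∈ ℓ`. -/
abbrev ChaosCoeff : Type := (ℕ →₀ ℕ) → ℂ

/-- `α! = α_1! α_2! ⋯`. -/
def multiFactorial (α : ℕ →₀ ℕ) : ℝ := α.prod fun _ n => (n.factorial : ℝ)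

/-- `(2ℕ)^α = 2^{α_1} (2·2)^{α_2} (2·3)^{α_3} ⋯`. -/
def twoNPow (α : ℕ →₀ ℕ) : ℝ := α.prod fun k n => (2 * ((k : ℝ) + 1)) ^ n

/-- The Kondratiev space `S_1` of stochastic test functions `∑ a_α H_α`. -/
def KondratievTest : Set ChaosCoeff :=
  {a | ∀ k : ℕ, Summable fun α => ‖a α‖ ^ 2 * multiFactorial α ^ 2 * twoNPow α ^ k}

/-- The Kondratiev space `S_{-1}` of stochastic distributions `∑ b_α H_α`. -/
def KondratievDist : Set ChaosCoeff :=
  {b | ∃ q : ℕ, Summable fun α => ‖b α‖ ^ 2 * (twoNPow α ^ q)⁻¹}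

/-- The duality `⟨F, f⟩ = ∑ α! a_α b_α` between `F = ∑ b_α H_α ∈ S_{-1}` and
`f = ∑ a_α H_α ∈ S_1`. -/
def kondratievPairing (F f : ChaosCoeff) : ℂ := ∑' α, (multiFactorial α : ℂ) * f α * F α

/-- `G = ∫_a^b Z(s) ds` in `S_{-1}`, in the weak sense: `G ∈ S_{-1}`, and for every `f ∈ S_1` the
function `s ↦ ⟨Z(s), f⟩` is integrable between `a` and `b` with integral `⟨G, f⟩`. -/
def IsWeakIntegral (Z : ℝ → ChaosCoeff) (a b : ℝ) (G : ChaosCoeff) : Prop :=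
  (∀ s, Z s ∈ KondratievDist) ∧ G ∈ KondratievDist ∧
    ∀ f ∈ KondratievTest,
      IntervalIntegrable (fun s => kondratievPairing (Z s) f) volume a b ∧
        kondratievPairing G f = ∫ s in a..b, kondratievPairing (Z s) f

/-- `F = ∑ c_α H_α` with (unconditional) convergence in `L²(Ω, P)`; this identifies the element `F`
of `L²(Ω, P)` with the coefficient family `c`. -/
def HasChaosExpansion (P : Measure WNSpace) (F : Lp ℂ 2 P) (c : ChaosCoeff) : Prop :=
  Tendsto (fun S : Finset (ℕ →₀ ℕ) =>
    eLpNorm (fun ω => F ω - ∑ α ∈ S, c α * (chaosBasis α ω : ℂ)) 2 P) atTop (𝓝 0)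

/-- The `m`-Brownian motion `B_m(t) = Q_{T_m I_t}`, as an element of `L²(Ω, P)`. -/
def mBrownian (P : Measure WNSpace) [IsWhiteNoiseMeasure P] {m : ℝ → ℝ}
    (hm : IsSpectralDensity m) (t : ℝ) : Lp ℂ 2 P :=
  wnQ P (Tm m ⟨indicatorL2 t, indicatorL2_mem_TmDomain hm t⟩)

/-- The coefficients of the formal series `∑_k c_k H_{ε^{(k)}}`: the value at `ε^{(k)}` is `c_k`,
and all other coefficients vanish. -/
def firstChaos (c : ℕ → ℂ) : ChaosCoeff := fun α =>
  ∑ k ∈ α.support, if α = Finsupp.single k 1 then c k else 0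

/-- The `m`-white noise `W_m(t) = ∑_k (T_m h̃_k)(t) H_{ε^{(k)}}`. -/
def mWhiteNoise {m : ℝ → ℝ} (hm : IsSpectralDensity m) (t : ℝ) : ChaosCoeff :=
  firstChaos fun k => TmHermite hm k t

end Kondratiev

end

/-! In the Fourier picture `T_m` is multiplication by the real function `√m`, hence symmetric. The
`k`-th Hermite coefficient of `T_m I_t` is therefore `⟨T_m h̃_k, I_t⟩`, and for even `m`, where `T_m
h̃_k` is real, this is `∫_0^t T_m h̃_k(s) ds` (`inner_hermiteL2_Tm_indicatorL2`). The Hermite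
functions form a Hilbert basis (`hermiteBasis`) and `Q` is continuous with `Q_{h̃_k} = H_{ε^(k)}`,
so these numbers are the chaos coefficients of `B_m(t)` (`hasChaosExpansion_wnQ`): formally,
`B_m(t)` is the series `W_m` integrated term by term.

What makes this rigorous is a bound on `T_m h̃_k(s)`, uniform in `s` and linear in `k`
(`exists_norm_TmHermite_le`). It rests on `√m |ĥ_k| ≤ m/(u²+1) + (u²+1)|ĥ_k|²`, whose last term
integrates, by Plancherel, to a multiple of `‖h̃_k'‖² + ‖h̃_k‖² = O(k)`. Linear growth puts `W_m(t)`
in `S_{-1}`. The first-chaos coefficients of a test function are summable against `k`, so the bound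
also dominates the paired series and allows sum and integral to be exchanged
(`kondratievPairing_integral_firstChaos`). -/

section HermitePolynomial

/-! ### Hermite polynomials and their Gaussian orthogonality. -/

theorem derivative_hermite_succ (n : ℕ) :
    Polynomial.derivative (Polynomial.hermite (n + 1)) =
      ((n : Polynomial ℤ) + 1) * Polynomial.hermite n := by
  induction n with
  | zero => simp
  | succ n ih =>
    rw [Polynomial.hermite_succ (n + 1), Polynomial.derivative_sub, Polynomial.derivative_mul, ih,
      Polynomial.derivative_mul, Polynomial.hermite_succ n]
    simp
    ring

/-- The probabilists' Hermite polynomials over `ℝ`. -/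
noncomputable def realHermite (n : ℕ) : Polynomial ℝ := (Polynomial.hermite n).map (algebraMap ℤ ℝ)

theorem realHermite_zero : realHermite 0 = 1 := by simp [realHermite]

theorem eval_realHermite (n : ℕ) (x : ℝ) :
    (realHermite n).eval x = Polynomial.aeval x (Polynomial.hermite n) := by
  rw [realHermite, Polynomial.aeval_def, Polynomial.eval_map]

theorem realHermite_succ (n : ℕ) : realHermite (n + 1) =
    Polynomial.X * realHermite n - Polynomial.derivative (realHermite n) := by
  simp [realHermite, Polynomial.hermite_succ, Polynomial.derivative_map]

theorem derivative_realHermite_zero : Polynomial.derivative (realHermite 0) = 0 := by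
  simp [realHermite_zero]

theorem derivative_realHermite_succ (n : ℕ) :
    Polynomial.derivative (realHermite (n + 1)) = ((n : Polynomial ℝ) + 1) * realHermite n := by
  rw [realHermite, Polynomial.derivative_map, derivative_hermite_succ]
  simp [realHermite]

theorem natDegree_realHermite (n : ℕ) : (realHermite n).natDegree = n := by
  rw [realHermite, (Polynomial.hermite_monic n).natDegree_map, Polynomial.natDegree_hermite]

theorem monic_realHermite (n : ℕ) : (realHermite n).Monic :=
  (Polynomial.hermite_monic n).map _

theorem integrable_polynomial_mul_gaussian (p : Polynomial ℝ) :
    Integrable fun x : ℝ => p.eval x * Real.exp (-(x ^ 2 / 2)) := by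
  refine ((SchwartzMap.smulLeftCLM ℝ (fun x : ℝ => p.eval x) gaussianSchwartz).integrable
    (μ := volume)).congr (ae_of_all _ fun x => ?_)
  simp only [SchwartzMap.smulLeftCLM_apply_apply (hasTemperateGrowth_polynomial p)]
  rfl

theorem hasDerivAt_gaussian (x : ℝ) : HasDerivAt (fun x : ℝ => Real.exp (-(x ^ 2 / 2)))
    (-x * Real.exp (-(x ^ 2 / 2))) x := by
  have h : HasDerivAt (fun x : ℝ => -(x ^ 2 / 2)) (-x) x := by
    refine ((((hasDerivAt_id' x).pow 2).div_const 2).neg).congr_deriv ?_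
    simp
  simpa [mul_comm] using h.exp

/-- The integrand is the derivative of `p` times the Gaussian, and both that product and its
derivative are integrable. -/
theorem integral_derivative_sub_X_mul_gaussian (p : Polynomial ℝ) :
    ∫ x : ℝ, (Polynomial.derivative p - Polynomial.X * p).eval x * Real.exp (-(x ^ 2 / 2)) = 0 := by
  refine integral_eq_zero_of_hasDerivAt_of_integrable
    (f := fun x => p.eval x * Real.exp (-(x ^ 2 / 2))) (fun x => ?_)
    (integrable_polynomial_mul_gaussian _) (integrable_polynomial_mul_gaussian _)
  refine ((p.hasDerivAt x).mul (hasDerivAt_gaussian x)).congr_deriv ?_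
  simp
  ring

/-- Integration by parts: `X - d/dx`, which raises the Hermite index, is the adjoint of `d/dx` for
the Gaussian weight. -/
theorem integral_realHermite_succ_mul (n : ℕ) (p : Polynomial ℝ) :
    ∫ x : ℝ, (realHermite (n + 1) * p).eval x * Real.exp (-(x ^ 2 / 2)) =
      ∫ x : ℝ, (realHermite n * Polynomial.derivative p).eval x * Real.exp (-(x ^ 2 / 2)) := by
  have h := integral_derivative_sub_X_mul_gaussian (realHermite n * p)
  rw [← sub_eq_zero, ← integral_sub (integrable_polynomial_mul_gaussian _)
    (integrable_polynomial_mul_gaussian _), ← neg_eq_zero, ← integral_neg, ← h]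
  congr 1 with x
  simp [realHermite_succ]
  ring

/-- Moving the raising operator across lowers both indices by one and yields the factor `k + 1`,
until one index is zero. -/
theorem integral_realHermite_mul (n k : ℕ) :
    ∫ x : ℝ, (realHermite n * realHermite k).eval x * Real.exp (-(x ^ 2 / 2)) =
      if n = k then (n.factorial : ℝ) * √(2 * Real.pi) else 0 := by
  induction n generalizing k with
  | zero =>
    cases k with
    | zero =>
      have := integral_gaussian (1 / 2)
      simp only [realHermite_zero, mul_one, Polynomial.eval_one, one_mul, if_true,
        Nat.factorial_zero, Nat.cast_one]
      convert this using 3 with x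
      · ring_nf
      · ring
    | succ k =>
      rw [mul_comm, integral_realHermite_succ_mul, derivative_realHermite_zero]
      simp
  | succ n ih =>
    rw [integral_realHermite_succ_mul]
    cases k with
    | zero => simp [derivative_realHermite_zero]
    | succ k =>
      have : ∀ x : ℝ, (realHermite n * Polynomial.derivative (realHermite (k + 1))).eval x *
          Real.exp (-(x ^ 2 / 2)) = ((k : ℝ) + 1) * ((realHermite n * realHermite k).eval x *
          Real.exp (-(x ^ 2 / 2))) := by
        intro x
        simp [derivative_realHermite_succ]
        ring
      simp_rw [this]
      rw [integral_const_mul, ih]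
      by_cases h : n = k
      · subst h
        simp [Nat.factorial_succ, mul_assoc]
      · simp [h]

end HermitePolynomial

/-! ### Hermite functions: orthonormality and size of the derivative. -/

section HermiteFunction

theorem hermiteFun_eq (k : ℕ) (x : ℝ) :
    hermiteFun k x = (realHermite k).eval (√2 * x) * Real.exp (-(x ^ 2 / 2)) /
      (Real.pi ^ (1 / 4 : ℝ) * √(k.factorial : ℝ)) := by
  rw [hermiteFun_apply, eval_realHermite]

theorem rpow_quarter_pi_mul_self :
    Real.pi ^ (1 / 4 : ℝ) * Real.pi ^ (1 / 4 : ℝ) = √Real.pi := by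
  rw [← Real.rpow_add Real.pi_pos, Real.sqrt_eq_rpow]
  norm_num

/-- The substitution `y = √2 x` turns the product of two Gaussian factors into the weight
`exp(-y²/2)`; its Jacobian `1/√2` reduces `√(2π)` to the normalizing `√π`. -/
theorem integral_hermiteFun_mul (j k : ℕ) :
    ∫ x : ℝ, hermiteFun j x * hermiteFun k x = if j = k then 1 else 0 := by
  have hpi := Real.pi_pos
  have h : ∀ x : ℝ, hermiteFun j x * hermiteFun k x =
      (√Real.pi * (√(j.factorial : ℝ) * √(k.factorial : ℝ)))⁻¹ *
        (fun y : ℝ => (realHermite j * realHermite k).eval y * Real.exp (-(y ^ 2 / 2)))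
          (√2 * x) := by
    intro x
    have e : Real.exp (-((√2 * x) ^ 2 / 2)) =
        Real.exp (-(x ^ 2 / 2)) * Real.exp (-(x ^ 2 / 2)) := by
      rw [← Real.exp_add, mul_pow, Real.sq_sqrt (by norm_num)]
      ring_nf
    simp only [hermiteFun_eq, Polynomial.eval_mul, e]
    rw [← rpow_quarter_pi_mul_self]
    field_simp
  simp_rw [h]
  rw [integral_const_mul, Measure.integral_comp_mul_left
    (fun y : ℝ => (realHermite j * realHermite k).eval y * Real.exp (-(y ^ 2 / 2))), integral_realHermite_mul]
  by_cases hjk : j = k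
  · subst hjk
    have h2 : (0 : ℝ) < √2 := by positivity
    have hf : (0 : ℝ) < j.factorial := by positivity
    simp only [if_true, smul_eq_mul]
    rw [Real.mul_self_sqrt hf.le, Real.sqrt_mul (by norm_num), abs_of_pos (by positivity)]
    have : √Real.pi ≠ 0 := by positivity
    field_simp
  · simp [hjk]

theorem orthonormal_hermiteL2 : Orthonormal ℂ hermiteL2 := by
  rw [orthonormal_iff_ite]
  intro j k
  rw [L2.inner_def]
  have : ∫ x, inner ℂ (hermiteL2 j x) (hermiteL2 k x) =
      ∫ x : ℝ, ((hermiteFun j x * hermiteFun k x : ℝ) : ℂ) := by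
    apply integral_congr_ae
    filter_upwards [SchwartzMap.coeFn_toLp ((hermiteFun j).postcompCLM Complex.ofRealCLM) 2 volume,
      SchwartzMap.coeFn_toLp ((hermiteFun k).postcompCLM Complex.ofRealCLM) 2 volume] with x h1 h2
    rw [hermiteL2, hermiteL2, h1, h2]
    simp [mul_comm]
  rw [this, integral_complex_ofReal, integral_hermiteFun_mul]
  split_ifs <;> simp

/-- The ladder relation. At `k = 0` the truncated index `k - 1` is harmless, since its coefficient
vanishes. -/
theorem deriv_hermiteFun (k : ℕ) (x : ℝ) : deriv (hermiteFun k) x =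
    √((k : ℝ) / 2) * hermiteFun (k - 1) x - √(((k : ℝ) + 1) / 2) * hermiteFun (k + 1) x := by
  have h2 : √2 * √2 = 2 := Real.mul_self_sqrt (by norm_num)
  have hd : HasDerivAt (hermiteFun k)
      (((Polynomial.derivative (realHermite k)).eval (√2 * x) * √2 * Real.exp (-(x ^ 2 / 2)) +
        (realHermite k).eval (√2 * x) * (-x * Real.exp (-(x ^ 2 / 2)))) /
      (Real.pi ^ (1 / 4 : ℝ) * √(k.factorial : ℝ))) x := by
    have h1 : HasDerivAt (fun x : ℝ => √2 * x) √2 x := by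
      simpa using (hasDerivAt_id x).const_mul √2
    have := ((((realHermite k).hasDerivAt (√2 * x)).comp x h1).mul
      (hasDerivAt_gaussian x)).div_const (Real.pi ^ (1 / 4 : ℝ) * √(k.factorial : ℝ))
    refine this.congr_of_eventuallyEq (Eventually.of_forall fun y => ?_)
    simp [hermiteFun_eq]
  rw [hd.deriv, hermiteFun_eq, hermiteFun_eq, realHermite_succ]
  have hf1 : √(((k + 1).factorial : ℕ) : ℝ) = √((k : ℝ) + 1) * √(k.factorial : ℝ) := by
    rw [Nat.factorial_succ, Nat.cast_mul, Real.sqrt_mul (by positivity)]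
    push_cast; rfl
  have hk1 : √((k : ℝ) + 1) ≠ 0 := by positivity
  rw [hf1, Real.sqrt_div (by positivity), Real.sqrt_div (by positivity)]
  cases k with
  | zero =>
    simp [realHermite_zero]
    field_simp
  | succ k =>
    have hf2 : √(((k + 1).factorial : ℕ) : ℝ) = √((k : ℝ) + 1) * √(k.factorial : ℝ) := by
      rw [Nat.factorial_succ, Nat.cast_mul, Real.sqrt_mul (by positivity)]
      push_cast; rfl
    have hk2 : √((k : ℝ) + 1) * √((k : ℝ) + 1) = k + 1 := Real.mul_self_sqrt (by positivity)
    rw [derivative_realHermite_succ, hf2]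
    simp only [Nat.add_sub_cancel]
    push_cast at hk1 ⊢
    simp only [Polynomial.eval_sub, Polynomial.eval_mul, Polynomial.eval_add, Polynomial.eval_X,
      Polynomial.eval_natCast, Polynomial.eval_one]
    field_simp
    linear_combination ((k : ℝ) + 1) * (realHermite k).eval (√2 * x) * h2 -
      (realHermite k).eval (√2 * x) * hk2

/-- Apply `(u - v)² ≤ 2u² + 2v²` to the ladder relation. Expanding by orthogonality would give `k +
1/2`, but only linear growth matters. -/
theorem integral_deriv_hermiteFun_sq_le (k : ℕ) :
    ∫ x : ℝ, deriv (hermiteFun k) x ^ 2 ≤ 2 * k + 1 := by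
  have hint : ∀ j, Integrable fun x : ℝ => hermiteFun j x * hermiteFun j x := fun j => by
    simpa [sq] using ((hermiteFun j).memLp 2 (volume : Measure ℝ)).integrable_sq
  have hi : ∀ j, ∫ x : ℝ, hermiteFun j x * hermiteFun j x = 1 := fun j => by
    simp [integral_hermiteFun_mul]
  calc ∫ x : ℝ, deriv (hermiteFun k) x ^ 2
      ≤ ∫ x : ℝ, (k * (hermiteFun (k - 1) x * hermiteFun (k - 1) x) +
          (k + 1) * (hermiteFun (k + 1) x * hermiteFun (k + 1) x)) := by
        refine integral_mono ?_ (((hint _).const_mul _).add ((hint _).const_mul _)) fun x => ?_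
        · exact ((SchwartzMap.derivCLM ℝ ℝ (hermiteFun k)).memLp 2
            (volume : Measure ℝ)).integrable_sq
        · simp only [deriv_hermiteFun]
          have h1 := Real.sq_sqrt (show (0 : ℝ) ≤ (k : ℝ) / 2 by positivity)
          have h2 := Real.sq_sqrt (show (0 : ℝ) ≤ ((k : ℝ) + 1) / 2 by positivity)
          set a := √((k : ℝ) / 2)
          set b := √(((k : ℝ) + 1) / 2)
          have := sq_nonneg (a * hermiteFun (k - 1) x + b * hermiteFun (k + 1) x)
          have e1 : (k : ℝ) = 2 * a ^ 2 := by linarith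
          have e2 : (k : ℝ) + 1 = 2 * b ^ 2 := by linarith
          rw [e2]
          conv_rhs => rw [e1]
          nlinarith
    _ = 2 * k + 1 := by
        rw [integral_add ((hint _).const_mul _) ((hint _).const_mul _), integral_const_mul,
          integral_const_mul, hi, hi]
        ring

end HermiteFunction

/-! ### Completeness of the Hermite functions in `L²(ℝ)`. -/

section Completeness

/-- The Hermite polynomials as a polynomial sequence. -/
noncomputable def realHermiteSequence : Polynomial.Sequence ℝ where
  elems' := realHermite
  degree_eq' n := by
    rw [Polynomial.degree_eq_natDegree (monic_realHermite n).ne_zero, natDegree_realHermite]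

theorem span_realHermite : Submodule.span ℝ (Set.range realHermite) = ⊤ :=
  realHermiteSequence.span fun n => by
    have : (realHermiteSequence n).leadingCoeff = 1 := monic_realHermite n
    rw [this]; exact isUnit_one

theorem memLp_exp_abs_mul_gaussian (a : ℝ) :
    MemLp (fun x : ℝ => Real.exp (a * |x|) * Real.exp (-(x ^ 2 / 2))) 2 volume := by
  rw [memLp_two_iff_integrable_sq (by fun_prop)]
  -- Completing the square: `2a|x| ≤ 2a² + x²/2`, so half of the Gaussian decay of the square
  -- survives.
  have hi : Integrable fun x : ℝ => Real.exp (a ^ 2) ^ 2 * Real.exp (-(1 / 2) * x ^ 2) :=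
    (integrable_exp_neg_mul_sq (by norm_num)).const_mul _
  refine hi.mono' (by fun_prop) (ae_of_all _ fun x => ?_)
  rw [Real.norm_of_nonneg (by positivity), ← Real.exp_add, ← Real.exp_nat_mul, ← Real.exp_nat_mul,
    ← Real.exp_add]
  apply Real.exp_le_exp.2
  push_cast
  nlinarith [sq_nonneg (a - |x| / 2), sq_abs x]

theorem integrable_exp_abs_mul_gaussian_mul (a : ℝ) (f : Lp ℂ 2 (volume : Measure ℝ)) :
    Integrable fun x : ℝ => Real.exp (a * |x|) * Real.exp (-(x ^ 2 / 2)) * ‖f x‖ :=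
  (memLp_exp_abs_mul_gaussian a).integrable_mul (Lp.memLp f).norm

theorem memLp_gaussian_mul (f : Lp ℂ 2 (volume : Measure ℝ)) :
    MemLp (fun x : ℝ => (Real.exp (-(x ^ 2 / 2)) : ℂ) * f x) 2 volume := by
  refine (Lp.memLp f).mono ?_ (ae_of_all _ fun x => ?_)
  · exact (by fun_prop : Continuous fun x : ℝ =>
      ((Real.exp (-(x ^ 2 / 2)) : ℝ) : ℂ)).aestronglyMeasurable.mul (Lp.aestronglyMeasurable f)
  · rw [norm_mul, Complex.norm_real, Real.norm_of_nonneg (Real.exp_pos _).le]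
    exact mul_le_of_le_one_left (norm_nonneg _)
      (Real.exp_le_one_iff.2 (by have := sq_nonneg x; linarith))

theorem integrable_gaussian_mul (f : Lp ℂ 2 (volume : Measure ℝ)) :
    Integrable (fun x : ℝ => (Real.exp (-(x ^ 2 / 2)) : ℂ) * f x) := by
  refine (integrable_exp_abs_mul_gaussian_mul 0 f).mono' (memLp_gaussian_mul f).1
    (ae_of_all _ fun x => ?_)
  simp only [norm_mul, Complex.norm_real, Real.norm_of_nonneg (Real.exp_pos _).le]
  simp

theorem integrable_pow_mul_gaussian_mul (n : ℕ) (f : Lp ℂ 2 (volume : Measure ℝ)) :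
    Integrable (fun x : ℝ => (x : ℂ) ^ n * ((Real.exp (-(x ^ 2 / 2)) : ℂ) * f x)) := by
  refine ((integrable_exp_abs_mul_gaussian_mul 1 f).const_mul (n.factorial : ℝ)).mono'
    ((by fun_prop : Continuous fun x : ℝ => (x : ℂ) ^ n).aestronglyMeasurable.mul
      (memLp_gaussian_mul f).1) (ae_of_all _ fun x => ?_)
  simp only [norm_mul, norm_pow, Complex.norm_real, Real.norm_of_nonneg (Real.exp_pos _).le]
  rw [← mul_assoc, ← mul_assoc, ← mul_assoc]
  gcongr
  have := Real.pow_div_factorial_le_exp |x| (abs_nonneg x) n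
  rw [div_le_iff₀ (by positivity)] at this
  rw [one_mul, Real.norm_eq_abs]
  linarith

theorem integrable_polynomial_mul_gaussian_mul (p : Polynomial ℝ)
    (f : Lp ℂ 2 (volume : Measure ℝ)) :
    Integrable (fun x : ℝ => ((p.eval x : ℝ) : ℂ) * ((Real.exp (-(x ^ 2 / 2)) : ℂ) * f x)) := by
  induction p using Polynomial.induction_on' with
  | add p q hp hq =>
    refine (hp.add hq).congr (ae_of_all _ fun x => ?_)
    simp [add_mul]
  | monomial n a =>
    refine ((integrable_pow_mul_gaussian_mul n f).const_mul (a : ℂ)).congr (ae_of_all _ fun x => ?_)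
    simp [mul_assoc]

theorem inner_hermiteL2 (k : ℕ) (f : Lp ℂ 2 (volume : Measure ℝ)) :
    inner ℂ (hermiteL2 k) f = ∫ x, (hermiteFun k x : ℂ) * f x := by
  rw [L2.inner_def]
  apply integral_congr_ae
  filter_upwards [SchwartzMap.coeFn_toLp ((hermiteFun k).postcompCLM Complex.ofRealCLM) 2 volume]
    with x h1
  rw [hermiteL2, h1]
  simp [mul_comm]

/-- The integral is linear in `p` and vanishes on the Hermite polynomials, which span all
polynomials. The dilation by `√2` matches the argument `√2 x` in the Hermite functions. -/
theorem integral_polynomial_mul_gaussian_mul_eq_zero {f : Lp ℂ 2 (volume : Measure ℝ)}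
    (hf : ∀ k, inner ℂ (hermiteL2 k) f = 0) (p : Polynomial ℝ) :
    ∫ x : ℝ, (((p.comp (Polynomial.C √2 * Polynomial.X)).eval x : ℝ) : ℂ) *
      ((Real.exp (-(x ^ 2 / 2)) : ℂ) * f x) = 0 := by
  have hp : p ∈ Submodule.span ℝ (Set.range realHermite) := by
    rw [span_realHermite]; trivial
  induction hp using Submodule.span_induction with
  | mem p hp =>
    obtain ⟨k, rfl⟩ := hp
    have h := hf k
    rw [inner_hermiteL2] at h
    have hc : ((Real.pi ^ (1 / 4 : ℝ) * √(k.factorial : ℝ) : ℝ) : ℂ) ≠ 0 :=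
      Complex.ofReal_ne_zero.2 (by positivity)
    rw [← mul_zero ((Real.pi ^ (1 / 4 : ℝ) * √(k.factorial : ℝ) : ℝ) : ℂ), ← h,
      ← integral_const_mul]
    congr 1 with x
    rw [hermiteFun_eq, Complex.ofReal_div]
    simp only [Polynomial.eval_comp, Polynomial.eval_mul, Polynomial.eval_C, Polynomial.eval_X]
    rw [Complex.ofReal_mul (Polynomial.eval _ _)]
    field_simp
  | zero => simp
  | add p q _ _ hp hq =>
    rw [← add_zero (0 : ℂ)]
    nth_rewrite 1 [← hp]
    rw [← hq, ← integral_add (integrable_polynomial_mul_gaussian_mul _ f)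
      (integrable_polynomial_mul_gaussian_mul _ f)]
    congr 1 with x
    simp [add_mul]
  | smul a p _ hp =>
    rw [← mul_zero (a : ℂ), ← hp, ← integral_const_mul]
    congr 1 with x
    simp [mul_assoc]

theorem integral_pow_mul_gaussian_mul_eq_zero {f : Lp ℂ 2 (volume : Measure ℝ)}
    (hf : ∀ k, inner ℂ (hermiteL2 k) f = 0) (n : ℕ) :
    ∫ x : ℝ, (x : ℂ) ^ n * ((Real.exp (-(x ^ 2 / 2)) : ℂ) * f x) = 0 := by
  rw [← integral_polynomial_mul_gaussian_mul_eq_zero hf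
    ((Polynomial.C (√2)⁻¹ * Polynomial.X) ^ n)]
  congr 1 with x
  have : √2 ≠ 0 := by positivity
  simp

/-- Expand the Fourier kernel as a power series: every term is a vanishing moment. The exchange is
dominated by `exp(|c||x|)` times the Gaussian times `|f|`, a product of two `L²` functions. -/
theorem fourier_gaussian_mul_eq_zero {f : Lp ℂ 2 (volume : Measure ℝ)}
    (hf : ∀ k, inner ℂ (hermiteL2 k) f = 0) (ξ : ℝ) :
    𝓕 (fun x : ℝ => (Real.exp (-(x ^ 2 / 2)) : ℂ) * f x) ξ = 0 := by
  set F : ℝ → ℂ := fun x => (Real.exp (-(x ^ 2 / 2)) : ℂ) * f x with hF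
  set c : ℂ := ((-2 * Real.pi * ξ : ℝ) : ℂ) * Complex.I with hc
  have hFn : ∀ x, ‖F x‖ = Real.exp (-(x ^ 2 / 2)) * ‖f x‖ := fun x => by
    rw [hF, norm_mul, Complex.norm_real, Real.norm_of_nonneg (Real.exp_pos _).le]
  have key : HasSum (fun n : ℕ => ∫ x : ℝ, (c * x) ^ n / n.factorial * F x)
      (∫ x : ℝ, Complex.exp (c * x) * F x) := by
    have hsum : ∀ x : ℝ, HasSum (fun n : ℕ => (‖c‖ * |x|) ^ n / n.factorial * ‖F x‖)
        (Real.exp (‖c‖ * |x|) * ‖F x‖) := fun x => by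
      have := (NormedSpace.expSeries_div_hasSum_exp (𝔸 := ℝ) (‖c‖ * |x|)).mul_right ‖F x‖
      rwa [← Real.exp_eq_exp_ℝ] at this
    refine hasSum_integral_of_dominated_convergence
      (fun (n : ℕ) x => (‖c‖ * |x|) ^ n / n.factorial * ‖F x‖) (fun n => ?_) (fun n => ?_)
      (ae_of_all _ fun x => (hsum x).summable) ?_ (ae_of_all _ fun x => ?_)
    · exact (by fun_prop : Continuous fun x : ℝ =>
        (c * x) ^ n / (n.factorial : ℂ)).aestronglyMeasurable.mul (memLp_gaussian_mul f).1
    · refine ae_of_all _ fun x => le_of_eq ?_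
      simp
    · simp_rw [fun x => (hsum x).tsum_eq, hFn, ← mul_assoc]
      exact integrable_exp_abs_mul_gaussian_mul ‖c‖ f
    · have := (NormedSpace.expSeries_div_hasSum_exp (𝔸 := ℂ) (c * x)).mul_right (F x)
      rwa [← Complex.exp_eq_exp_ℂ] at this
  have hz : ∀ n : ℕ, ∫ x : ℝ, (c * x) ^ n / n.factorial * F x = 0 := fun n => by
    rw [← mul_zero (c ^ n / n.factorial), ← integral_pow_mul_gaussian_mul_eq_zero hf n,
      ← integral_const_mul]
    congr 1 with x
    rw [mul_pow]; ring
  simp only [hz] at key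
  rw [Real.fourier_real_eq_integral_exp_smul, ← key.unique hasSum_zero]
  congr 1 with x
  rw [smul_eq_mul, hc]
  congr 2
  push_cast; ring

/-- By Plancherel the Gaussian times `f` is zero, and the Gaussian has no zeros. -/
theorem eq_zero_of_inner_hermiteL2_eq_zero {f : Lp ℂ 2 (volume : Measure ℝ)}
    (hf : ∀ k, inner ℂ (hermiteL2 k) f = 0) : f = 0 := by
  have h1 : (𝓕 (memLp_gaussian_mul f).toLp : Lp ℂ 2 (volume : Measure ℝ)) = 0 := by
    rw [Lp.eq_zero_iff_ae_eq_zero]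
    filter_upwards [fourier_toLp_ae (integrable_gaussian_mul f) (memLp_gaussian_mul f)] with ξ hξ
    rw [hξ, fourier_gaussian_mul_eq_zero hf]; rfl
  have h2 : (memLp_gaussian_mul f).toLp = 0 := by
    rw [← norm_eq_zero, ← Lp.norm_fourier_eq, h1, norm_zero]
  rw [Lp.eq_zero_iff_ae_eq_zero]
  rw [Lp.eq_zero_iff_ae_eq_zero] at h2
  filter_upwards [h2, (memLp_gaussian_mul f).coeFn_toLp] with x hx hx'
  rw [hx'] at hx
  simpa using hx

/-- The Hermite functions as a Hilbert basis of `L²(ℝ)`. -/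
noncomputable def hermiteBasis : HilbertBasis ℕ ℂ (Lp ℂ 2 (volume : Measure ℝ)) :=
  HilbertBasis.mkOfOrthogonalEqBot orthonormal_hermiteL2 <| by
    rw [Submodule.eq_bot_iff]
    intro f hf
    rw [Submodule.mem_orthogonal] at hf
    exact eq_zero_of_inner_hermiteL2_eq_zero fun k => hf _ (Submodule.subset_span ⟨k, rfl⟩)

theorem hermiteBasis_apply (k : ℕ) : hermiteBasis k = hermiteL2 k := by
  simp [hermiteBasis]

end Completeness

/-! ### The functions `T_m h̃_k`: growth, reality, symmetry of `T_m`. -/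

section TmHermite

/-- The Fourier transform of the `k`-th Hermite function. -/
noncomputable def hermiteFourier (k : ℕ) : 𝓢(ℝ, ℂ) := 𝓕 ((hermiteFun k).postcompCLM Complex.ofRealCLM)

theorem TmSymbol_hermiteL2_ae (m : ℝ → ℝ) (k : ℕ) : TmSymbol m (hermiteL2 k) =ᵐ[volume]
    fun ξ => (√(m (2 * Real.pi * ξ)) : ℂ) * hermiteFourier k ξ := by
  rw [show TmSymbol m (hermiteL2 k) = fun ξ => (√(m (2 * Real.pi * ξ)) : ℂ) *
    ((hermiteFourier k).toLp 2 (volume : Measure ℝ)) ξ by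
      ext ξ; rw [TmSymbol, hermiteL2, SchwartzMap.toLp_fourier_eq]; rfl]
  filter_upwards [(hermiteFourier k).coeFn_toLp 2 (volume : Measure ℝ)] with ξ hξ
  rw [hξ]

variable {m : ℝ → ℝ} (hm : IsSpectralDensity m)

theorem continuous_TmHermite (k : ℕ) : Continuous (TmHermite hm k) :=
  (exists_continuous_Tm_hermite hm k).choose_spec.1

theorem Tm_hermiteL2_ae (k : ℕ) :
    Tm m ⟨hermiteL2 k, hermiteL2_mem_TmDomain hm k⟩ =ᵐ[volume] TmHermite hm k :=
  (exists_continuous_Tm_hermite hm k).choose_spec.2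

/-- Continuous functions that agree almost everywhere agree everywhere, so the chosen representative
has an explicit formula at every point. -/
theorem TmHermite_eq_fourierInv (k : ℕ) :
    TmHermite hm k = 𝓕⁻ (TmSymbol m (hermiteL2 k)) := by
  have hc : Continuous (𝓕⁻ (TmSymbol m (hermiteL2 k))) :=
    VectorFourier.fourierIntegral_continuous Real.continuous_fourierChar
      (by exact continuous_inner.neg) (integrable_TmSymbol_hermiteL2 hm k)
  refine (Continuous.ae_eq_iff_eq volume (continuous_TmHermite hm k) hc).1 ?_
  exact (Tm_hermiteL2_ae hm k).symm.trans
    (fourierInv_toLp_ae (integrable_TmSymbol_hermiteL2 hm k) (hermiteL2_mem_TmDomain hm k))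

theorem TmHermite_eq_integral (k : ℕ) (t : ℝ) :
    TmHermite hm k t = ∫ ξ : ℝ, Complex.exp ((2 * Real.pi * (ξ * t) : ℝ) * Complex.I) *
      ((√(m (2 * Real.pi * ξ)) : ℂ) * hermiteFourier k ξ) := by
  rw [TmHermite_eq_fourierInv, Real.fourierInv_eq']
  apply integral_congr_ae
  filter_upwards [TmSymbol_hermiteL2_ae m k] with ξ hξ
  rw [hξ, smul_eq_mul]
  simp [mul_comm]

theorem integral_norm_sq_hermiteFourier (k : ℕ) : ∫ ξ : ℝ, ‖hermiteFourier k ξ‖ ^ 2 = 1 := by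
  rw [hermiteFourier, SchwartzMap.integral_norm_sq_fourier]
  have := integral_hermiteFun_mul k k
  simpa [sq] using this

theorem deriv_ofReal_hermiteFun (k : ℕ) (x : ℝ) :
    deriv ((hermiteFun k).postcompCLM Complex.ofRealCLM) x = ((deriv (hermiteFun k) x : ℝ) : ℂ) :=
  ((hermiteFun k).hasDerivAt x).ofReal_comp.deriv

/-- Up to a factor `i` the integrand comes from the Fourier transform of the derivative, so
Plancherel reduces this to the derivative bound. -/
theorem integral_norm_sq_mul_hermiteFourier_le (k : ℕ) :
    ∫ ξ : ℝ, ‖(2 * Real.pi * ξ : ℂ) * hermiteFourier k ξ‖ ^ 2 ≤ 2 * k + 1 := by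
  set S : 𝓢(ℝ, ℂ) := (hermiteFun k).postcompCLM Complex.ofRealCLM
  set D : 𝓢(ℝ, ℂ) := SchwartzMap.derivCLM ℝ ℂ S
  have hD : ∀ ξ : ℝ, (𝓕 D) ξ = (2 * Real.pi * Complex.I * ξ) • hermiteFourier k ξ := fun ξ =>
    congrFun (Real.fourier_deriv (S.integrable (μ := volume)) S.differentiable
      (D.integrable (μ := volume))) ξ
  refine le_trans (le_of_eq ?_) (integral_deriv_hermiteFun_sq_le k)
  calc ∫ ξ : ℝ, ‖(2 * Real.pi * ξ : ℂ) * hermiteFourier k ξ‖ ^ 2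
      = ∫ ξ : ℝ, ‖(𝓕 D) ξ‖ ^ 2 := by
        congr 1 with ξ
        rw [hD]
        simp
    _ = ∫ x : ℝ, ‖D x‖ ^ 2 := SchwartzMap.integral_norm_sq_fourier D
    _ = _ := by
        congr 1 with x
        rw [show D x = ((deriv (hermiteFun k) x : ℝ) : ℂ) from deriv_ofReal_hermiteFun k x]
        simp

theorem integrable_norm_sq_mul_hermiteFourier (k : ℕ) :
    Integrable fun ξ : ℝ => ‖(2 * Real.pi * ξ : ℂ) * hermiteFourier k ξ‖ ^ 2 := by
  have h := (SchwartzMap.smulLeftCLM ℂ (fun x : ℝ => x) (hermiteFourier k)).memLp 2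
    (volume : Measure ℝ)
  refine (h.norm.integrable_sq.const_mul ((2 * Real.pi) ^ 2)).congr (ae_of_all _ fun ξ => ?_)
  simp only [SchwartzMap.smulLeftCLM_apply_apply Function.HasTemperateGrowth.id', norm_smul,
    norm_mul, Complex.norm_real]
  simp [abs_of_pos Real.pi_pos]
  ring

/-- The function `T_m h̃_{k+1}` is bounded, with a bound that grows at most linearly in `k`. -/
theorem exists_norm_TmHermite_le :
    ∃ C : ℝ, ∀ (k : ℕ) (t : ℝ), ‖TmHermite hm k t‖ ≤ C * (k + 1) := by
  have hpi : (2 * Real.pi) ≠ 0 := by positivity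
  have hA : Integrable fun ξ : ℝ => m (2 * Real.pi * ξ) / ((2 * Real.pi * ξ) ^ 2 + 1) :=
    hm.integrable.comp_mul_left' hpi
  set A := ∫ ξ : ℝ, m (2 * Real.pi * ξ) / ((2 * Real.pi * ξ) ^ 2 + 1) with hAdef
  have hA0 : 0 ≤ A := integral_nonneg fun ξ => div_nonneg (hm.nonneg _) (by positivity)
  -- The estimate ends at `A + (2k + 1) + 1`, with the `2k + 1` from the derivative and the last `1`
  -- from the normalization.
  refine ⟨A + 2, fun k t => ?_⟩
  have hB := integrable_norm_sq_mul_hermiteFourier k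
  have hC : Integrable fun ξ : ℝ => ‖hermiteFourier k ξ‖ ^ 2 :=
    ((hermiteFourier k).memLp 2 (volume : Measure ℝ)).norm.integrable_sq
  have hint : Integrable fun ξ : ℝ => (√(m (2 * Real.pi * ξ)) : ℂ) * hermiteFourier k ξ :=
    (integrable_TmSymbol_hermiteL2 hm k).congr (TmSymbol_hermiteL2_ae m k)
  calc ‖TmHermite hm k t‖
      ≤ ∫ ξ : ℝ, ‖(√(m (2 * Real.pi * ξ)) : ℂ) * hermiteFourier k ξ‖ := by
        rw [TmHermite_eq_integral]
        refine (norm_integral_le_integral_norm _).trans (le_of_eq ?_)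
        congr 1 with ξ
        rw [norm_mul, Complex.norm_exp_ofReal_mul_I, one_mul]
    _ ≤ ∫ ξ : ℝ, (m (2 * Real.pi * ξ) / ((2 * Real.pi * ξ) ^ 2 + 1) +
          (‖(2 * Real.pi * ξ : ℂ) * hermiteFourier k ξ‖ ^ 2 + ‖hermiteFourier k ξ‖ ^ 2)) := by
        refine integral_mono hint.norm (hA.add (hB.add hC)) fun ξ => ?_
        have h0 := hm.nonneg (2 * Real.pi * ξ)
        have hv : 0 < (2 * Real.pi * ξ) ^ 2 + 1 := by positivity
        have e1 : ‖(2 * Real.pi * ξ : ℂ) * hermiteFourier k ξ‖ ^ 2 + ‖hermiteFourier k ξ‖ ^ 2 =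
            ((2 * Real.pi * ξ) ^ 2 + 1) * ‖hermiteFourier k ξ‖ ^ 2 := by
          rw [show (2 * Real.pi * ξ : ℂ) = ((2 * Real.pi * ξ : ℝ) : ℂ) by push_cast; rfl,
            norm_mul, Complex.norm_real, mul_pow, Real.norm_eq_abs, sq_abs]
          ring
        have e2 := Real.sq_sqrt h0
        simp only [e1]
        rw [norm_mul, Complex.norm_real, Real.norm_of_nonneg (Real.sqrt_nonneg _)]
        set v := (2 * Real.pi * ξ) ^ 2 + 1
        set r := √(m (2 * Real.pi * ξ))
        set g := ‖hermiteFourier k ξ‖ with hg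
        have hg0 : 0 ≤ g := norm_nonneg _
        have hr0 : 0 ≤ r := Real.sqrt_nonneg _
        -- A weighted AM-GM inequality with weight `v = (2πξ)² + 1`.
        rw [← e2, ← sub_nonneg, show r ^ 2 / v + v * g ^ 2 - r * g =
          ((r - v * g) ^ 2 + r * (v * g)) / v by field_simp; ring]
        positivity
    _ = A + ((∫ ξ : ℝ, ‖(2 * Real.pi * ξ : ℂ) * hermiteFourier k ξ‖ ^ 2) + 1) := by
        have hBC : Integrable fun ξ : ℝ => ‖(2 * Real.pi * ξ : ℂ) * hermiteFourier k ξ‖ ^ 2 +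
            ‖hermiteFourier k ξ‖ ^ 2 := hB.add hC
        rw [integral_add hA hBC, integral_add hB hC, integral_norm_sq_hermiteFourier]
    _ ≤ A + ((2 * k + 1) + 1) := by
        gcongr
        exact integral_norm_sq_mul_hermiteFourier_le k
    _ ≤ (A + 2) * (k + 1) := by
        have : 0 ≤ A * k := by positivity
        linarith

theorem conj_hermiteFourier_neg (k : ℕ) (ξ : ℝ) :
    (starRingEnd ℂ) (hermiteFourier k (-ξ)) = hermiteFourier k ξ := by
  have h : ∀ η : ℝ, hermiteFourier k η =
      ∫ x : ℝ, Complex.exp ((-2 * Real.pi * x * η : ℝ) * Complex.I) * (hermiteFun k x : ℂ) := by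
    intro η
    rw [hermiteFourier, SchwartzMap.fourier_coe, Real.fourier_real_eq_integral_exp_smul]
    rfl
  rw [h, h, ← integral_conj]
  congr 1 with x
  rw [map_mul, Complex.conj_ofReal, ← Complex.exp_conj, map_mul, Complex.conj_ofReal,
    Complex.conj_I]
  congr 2
  push_cast; ring

/-- Conjugating the inversion integral amounts to the reflection `ξ ↦ -ξ`, because `h̃_k` is real
and `m` is even. -/
theorem conj_TmHermite (heven : ∀ᵐ u : ℝ, m (-u) = m u) (k : ℕ) (t : ℝ) :
    (starRingEnd ℂ) (TmHermite hm k t) = TmHermite hm k t := by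
  have hpi : (2 * Real.pi) ≠ 0 := by positivity
  -- Evenness holds only almost everywhere; it survives the dilation because dilations pull null
  -- sets back to null sets.
  have heven' : ∀ᵐ ξ : ℝ, m (-(2 * Real.pi * ξ)) = m (2 * Real.pi * ξ) :=
    (Measure.quasiMeasurePreserving_smul (volume : Measure ℝ) hpi).ae heven
  rw [TmHermite_eq_integral, ← integral_conj, ← integral_neg_eq_self]
  apply integral_congr_ae
  filter_upwards [heven'] with ξ hξ
  rw [map_mul, map_mul, conj_hermiteFourier_neg, Complex.conj_ofReal, ← Complex.exp_conj, map_mul,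
    Complex.conj_ofReal, Complex.conj_I, mul_neg, mul_neg (2 * Real.pi), hξ]
  congr 2
  push_cast; ring

/-- By Plancherel this is the symmetry of multiplication by a real function. -/
theorem inner_Tm_eq (f g : TmDomain m) :
    inner ℂ (f : Lp ℂ 2 (volume : Measure ℝ)) (Tm m g) =
      inner ℂ (Tm m f) (g : Lp ℂ 2 (volume : Measure ℝ)) := by
  have hT : ∀ f : TmDomain m,
      (𝓕 (Tm m f) : Lp ℂ 2 (volume : Measure ℝ)) = (memLp_TmSymbol f).toLp := fun f =>
    FourierTransform.fourier_fourierInv_eq _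
  rw [← Lp.inner_fourier_eq, ← Lp.inner_fourier_eq (Tm m f), hT, hT, L2.inner_def, L2.inner_def]
  apply integral_congr_ae
  filter_upwards [(memLp_TmSymbol f).coeFn_toLp, (memLp_TmSymbol g).coeFn_toLp] with ξ h1 h2
  rw [h1, h2, TmSymbol, TmSymbol]
  simp only [RCLike.inner_apply, map_mul, Complex.conj_ofReal]
  ring

/-- Symmetry moves `T_m` onto `h̃_k`, now in the conjugate-linear slot; reality of `T_m h̃_k`
removes the conjugate. -/
theorem inner_hermiteL2_Tm_indicatorL2 (heven : ∀ᵐ u : ℝ, m (-u) = m u) (k : ℕ) (t : ℝ) :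
    inner ℂ (hermiteL2 k) (Tm m ⟨indicatorL2 t, indicatorL2_mem_TmDomain hm t⟩) =
      ∫ s in (0 : ℝ)..t, TmHermite hm k s := by
  refine (inner_Tm_eq ⟨hermiteL2 k, hermiteL2_mem_TmDomain hm k⟩
    ⟨indicatorL2 t, indicatorL2_mem_TmDomain hm t⟩).trans ?_
  rw [L2.inner_def, ← integral_mul_indicatorFun t (continuous_TmHermite hm k)]
  apply integral_congr_ae
  filter_upwards [Tm_hermiteL2_ae hm k, (memLp_indicatorFun t 2).coeFn_toLp] with s h1 h2
  refine (congrArg₂ (inner ℂ) h1 h2).trans ?_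
  rw [RCLike.inner_apply, conj_TmHermite hm heven, mul_comm]

end TmHermite

/-! ### Series in the first chaos: membership, pairing, expansion of `Q_g`. -/

section FirstChaos

theorem injective_single_one : Function.Injective fun k : ℕ => Finsupp.single k 1 :=
  Finsupp.single_left_injective one_ne_zero

theorem firstChaos_single (c : ℕ → ℂ) (k : ℕ) : firstChaos c (Finsupp.single k 1) = c k := by
  simp [firstChaos]

theorem firstChaos_of_notMem_range (c : ℕ → ℂ) {α : ℕ →₀ ℕ}
    (hα : α ∉ Set.range fun k : ℕ => Finsupp.single k 1) : firstChaos c α = 0 :=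
  Finset.sum_eq_zero fun k _ => if_neg fun h => hα ⟨k, h.symm⟩

theorem multiFactorial_single_one (k : ℕ) : multiFactorial (Finsupp.single k 1) = 1 := by
  simp [multiFactorial]

theorem twoNPow_single_one (k : ℕ) : twoNPow (Finsupp.single k 1) = 2 * ((k : ℝ) + 1) := by
  simp [twoNPow]

theorem chaosBasis_single_one (k : ℕ) (ω : WNSpace) :
    chaosBasis (Finsupp.single k 1) ω = ω (hermiteFun k) := by
  rw [chaosBasis, Finsupp.prod_single_index (by simp)]
  simp

theorem summable_inv_succ_sq : Summable fun k : ℕ => (((k : ℝ) + 1) ^ 2)⁻¹ := by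
  simpa using (summable_nat_add_iff 1).2 (Real.summable_nat_pow_inv.2 one_lt_two)

/-- A series in the first chaos whose coefficients grow at most linearly is in `S_{-1}`. -/
theorem firstChaos_mem_KondratievDist {c : ℕ → ℂ} {C : ℝ} (hc : ∀ k, ‖c k‖ ≤ C * (k + 1)) :
    firstChaos c ∈ KondratievDist := by
  -- The squared coefficients are `O(k²)`, so the weight exponent `4` leaves the convergent `∑ k⁻²`.
  refine ⟨4, (injective_single_one.summable_iff fun α hα => ?_).1 ?_⟩
  · simp [firstChaos_of_notMem_range c hα]
  · refine Summable.of_nonneg_of_le (fun k => ?_) (fun k => ?_)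
      (summable_inv_succ_sq.mul_left (C ^ 2))
    · simp only [Function.comp_apply, twoNPow_single_one]; positivity
    · simp only [Function.comp_apply, firstChaos_single, twoNPow_single_one]
      have h := pow_le_pow_left₀ (norm_nonneg _) (hc k) 2
      rw [← div_eq_mul_inv, ← div_eq_mul_inv, div_le_div_iff₀ (by positivity) (by positivity)]
      calc ‖c k‖ ^ 2 * ((k : ℝ) + 1) ^ 2
          ≤ (C * (k + 1)) ^ 2 * ((k : ℝ) + 1) ^ 2 := by gcongr
        _ ≤ C ^ 2 * (2 * ((k : ℝ) + 1)) ^ 4 := by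
          have : 0 ≤ C ^ 2 * ((k : ℝ) + 1) ^ 4 := by positivity
          linarith

/-- With `a = |f_{ε^(k)}|` and `b = k + 1`, `ab = (ab²)b⁻¹ ≤ a²b⁴ + b⁻²`; the first term is
controlled by the test-space condition with exponent `4`. -/
theorem summable_norm_mul_of_mem_KondratievTest {f : ChaosCoeff} (hf : f ∈ KondratievTest) :
    Summable fun k : ℕ => ‖f (Finsupp.single k 1)‖ * ((k : ℝ) + 1) := by
  have h := (hf 4).comp_injective injective_single_one
  refine Summable.of_nonneg_of_le (fun k => by positivity) (fun k => ?_)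
    (h.add summable_inv_succ_sq)
  simp only [Function.comp_apply, multiFactorial_single_one, twoNPow_single_one]
  set a := ‖f (Finsupp.single k 1)‖
  set b := (k : ℝ) + 1 with hb
  have hb0 : 0 < b := by positivity
  have ha0 : 0 ≤ a := norm_nonneg _
  have e : a * b = (a * b ^ 2) * b⁻¹ := by field_simp
  have h0 : 0 ≤ a ^ 2 * b ^ 4 := by positivity
  rw [e, ← inv_pow]
  nlinarith [sq_nonneg (a * b ^ 2 - b⁻¹), sq_nonneg (a * b ^ 2), sq_nonneg b⁻¹]

theorem kondratievPairing_firstChaos (c : ℕ → ℂ) (f : ChaosCoeff) :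
    kondratievPairing (firstChaos c) f = ∑' k : ℕ, f (Finsupp.single k 1) * c k := by
  rw [kondratievPairing, ← injective_single_one.tsum_eq]
  · simp [firstChaos_single, multiFactorial_single_one]
  · intro α hα
    by_contra h
    exact hα (by simp [firstChaos_of_notMem_range c h])

/-- Termwise integration of a series in the first chaos whose coefficients are continuous functions
with a uniform bound that grows at most linearly. -/
theorem kondratievPairing_integral_firstChaos {c : ℕ → ℝ → ℂ} (hc : ∀ k, Continuous (c k)) {C : ℝ}
    (hC : ∀ k s, ‖c k s‖ ≤ C * (k + 1)) {f : ChaosCoeff} (hf : f ∈ KondratievTest) (a b : ℝ) :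
    IntervalIntegrable (fun s => kondratievPairing (firstChaos fun k => c k s) f) volume a b ∧
      kondratievPairing (firstChaos fun k => ∫ s in a..b, c k s) f =
        ∫ s in a..b, kondratievPairing (firstChaos fun k => c k s) f := by
  have hs := (summable_norm_mul_of_mem_KondratievTest hf).mul_right C
  have hle : ∀ k s, ‖f (Finsupp.single k 1) * c k s‖ ≤
      ‖f (Finsupp.single k 1)‖ * ((k : ℝ) + 1) * C := by
    intro k s
    rw [norm_mul, mul_assoc, mul_comm _ C]
    gcongr
    exact hC k s
  have hcont : ∀ k, Continuous fun s => f (Finsupp.single k 1) * c k s := fun k =>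
    continuous_const.mul (hc k)
  simp only [kondratievPairing_firstChaos]
  -- By the Weierstrass M-test the pairing is continuous in `s`; the same majorants, constant in
  -- `s`, justify termwise integration.
  refine ⟨(continuous_tsum hcont hs hle).intervalIntegrable _ _, ?_⟩
  have key := intervalIntegral.hasSum_integral_of_dominated_convergence (μ := volume)
    (a := a) (b := b) (F := fun (k : ℕ) s => f (Finsupp.single k 1) * c k s)
    (f := fun s => ∑' k : ℕ, f (Finsupp.single k 1) * c k s)
    (fun k _ => ‖f (Finsupp.single k 1)‖ * ((k : ℝ) + 1) * C)
    (fun k => (hcont k).aestronglyMeasurable) (fun k => ae_of_all _ fun s _ => hle k s)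
    (ae_of_all _ fun s _ => hs) (intervalIntegrable_const)
    (ae_of_all _ fun s _ => (Summable.of_norm_bounded hs fun k => hle k s).hasSum)
  rw [← key.tsum_eq]
  simp

/-- Since `h_1(x) = x`, the right-hand side is `H_{ε^(k)}`; this links the Hermite expansion to the
chaos expansion. -/
theorem wnQ_hermiteL2_ae (P : Measure WNSpace) [IsWhiteNoiseMeasure P] (k : ℕ) :
    wnQ P (hermiteL2 k) =ᵐ[P] fun ω => (ω (hermiteFun k) : ℂ) := by
  rw [hermiteL2, wnQ_toLp]
  filter_upwards [(memLp_wnPairing P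
    ((hermiteFun k).postcompCLM Complex.ofRealCLM)).coeFn_toLp] with ω hω
  refine hω.trans ?_
  have hre : ((hermiteFun k).postcompCLM Complex.ofRealCLM).postcompCLM Complex.reCLM =
      hermiteFun k := by ext x; simp
  have him : ((hermiteFun k).postcompCLM Complex.ofRealCLM).postcompCLM Complex.imCLM = 0 := by
    ext x; simp
  rw [wnPairing, hre, him]
  simp

/-- The chaos expansion of `Q_g` is its expansion in the Hermite functions. -/
theorem hasChaosExpansion_wnQ (P : Measure WNSpace) [IsWhiteNoiseMeasure P]
    (g : Lp ℂ 2 (volume : Measure ℝ)) :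
    HasChaosExpansion P (wnQ P g) (firstChaos fun k => inner ℂ (hermiteL2 k) g) := by
  set c : ℕ → ℂ := fun k => inner ℂ (hermiteL2 k) g
  have hsum : HasSum (fun k => c k • wnQ P (hermiteL2 k)) (wnQ P g) := by
    have h := (hermiteBasis.hasSum_repr g).mapL (wnQ P)
    simpa only [hermiteBasis.repr_apply_apply, hermiteBasis_apply, map_smul] using h
  have hsub : Tendsto (fun T : Finset ℕ => ‖wnQ P g - ∑ k ∈ T, c k • wnQ P (hermiteL2 k)‖ₑ)
      atTop (𝓝 0) := by
    have h : Tendsto (fun T : Finset ℕ => wnQ P g - ∑ k ∈ T, c k • wnQ P (hermiteL2 k))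
        atTop (𝓝 (wnQ P g - wnQ P g)) := Tendsto.sub tendsto_const_nhds hsum
    simpa using h.enorm
  -- A partial sum over multi-indices `S` only sees the unit sequences in `S`, so it is a partial
  -- sum of the Hermite series over their positions.
  refine (hsub.comp (tendsto_finset_preimage_atTop_atTop injective_single_one)).congr fun S => ?_
  rw [Function.comp_apply, Lp.enorm_def]
  apply eLpNorm_congr_ae
  set T := S.preimage (fun k : ℕ => Finsupp.single k 1) injective_single_one.injOn
  have hsmul : ∀ᵐ ω ∂P, ∀ k, (c k • wnQ P (hermiteL2 k) : Lp ℂ 2 P) ω =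
      c k * (ω (hermiteFun k) : ℂ) := by
    rw [ae_all_iff]
    intro k
    filter_upwards [Lp.coeFn_smul (c k) (wnQ P (hermiteL2 k)), wnQ_hermiteL2_ae P k] with ω h1 h2
    rw [h1, Pi.smul_apply, h2, smul_eq_mul]
  filter_upwards [Lp.coeFn_sub (wnQ P g) (∑ k ∈ T, c k • wnQ P (hermiteL2 k)),
    Lp.coeFn_finsetSum T (fun k => c k • wnQ P (hermiteL2 k)), hsmul] with ω h1 h2 h3
  rw [h1, Pi.sub_apply, h2, ← Finset.sum_preimage (fun k : ℕ => Finsupp.single k 1) S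
    injective_single_one.injOn (fun α => firstChaos c α * (chaosBasis α ω : ℂ))]
  · simp only [Finset.sum_apply, h3, firstChaos_single, chaosBasis_single_one]
    rfl
  · intro α _ hα
    rw [firstChaos_of_notMem_range c hα, zero_mul]

theorem norm_inner_hermiteL2_le (g : Lp ℂ 2 (volume : Measure ℝ)) (k : ℕ) :
    ‖inner ℂ (hermiteL2 k) g‖ ≤ ‖g‖ := by
  simpa [orthonormal_hermiteL2.norm_eq_one k] using norm_inner_le_norm (𝕜 := ℂ) (hermiteL2 k) g

end FirstChaos

theorem theorem7p3 (P : Measure WNSpace) [IsWhiteNoiseMeasure P] {m : ℝ → ℝ}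
    (hm : IsSpectralDensity m) :
    (∀ t : ℝ, mWhiteNoise hm t ∈ KondratievDist) ∧
      ((∀ᵐ u : ℝ, m (-u) = m u) → ∀ t : ℝ, ∃ b : ChaosCoeff,
        HasChaosExpansion P (mBrownian P hm t) b ∧
          IsWeakIntegral (mWhiteNoise hm) 0 t b) := by
  obtain ⟨C, hC⟩ := exists_norm_TmHermite_le hm
  have hW : ∀ t : ℝ, mWhiteNoise hm t ∈ KondratievDist := fun t =>
    firstChaos_mem_KondratievDist fun k => hC k t
  refine ⟨hW, fun heven t => ?_⟩
  set g := Tm m ⟨indicatorL2 t, indicatorL2_mem_TmDomain hm t⟩ with hg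
  refine ⟨firstChaos fun k => inner ℂ (hermiteL2 k) g, hasChaosExpansion_wnQ P g, hW,
    -- By Cauchy-Schwarz the coefficients of `B_m(t)` are even bounded, by `‖g‖`.
    firstChaos_mem_KondratievDist (C := ‖g‖) fun k => ?_, fun f hf => ?_⟩
  · refine (norm_inner_hermiteL2_le g k).trans (le_mul_of_one_le_right (norm_nonneg _) ?_)
    have : (0 : ℝ) ≤ k := k.cast_nonneg
    linarith
  · rw [funext fun k => inner_hermiteL2_Tm_indicatorL2 hm heven k t]
    exact kondratievPairing_integral_firstChaos (continuous_TmHermite hm) hC hf 0 t
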